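/- Let $k$ be a field of characteristic $0$, let $X$ be an irreducible scheme of finite type over $k$ that is regular (all local rings $\mathcal O_{X,x}$ are regular), let $M$ be a locally free $\mathcal O_X$-module of finite rank, and let $V\subset\Gamma(X,M)$ be a finite-dimensional $k$-subspace. For $n\ge 0$ let $\mathcal P^n_{X/k}=\Delta^{-1}(\mathcal O_{X\times_k X})/I_\Delta^{n+1}$ be the sheaf of principal parts of order $n$, where $\Delta:X\to X\times_k X$ is the diagonal and $I_\Delta=\ker(\Delta^{-1}\mathcal O_{X\times_kX}\to\mathcal O_X)$; put $\mathcal P^n_{X/k}(M)=\mathcal P^n_{X/k}\otimes_{\mathcal O_X}M$ (tensor product along the second factor, regarded as an $\mathcal O_X$-module through the first factor), let $d^n:M\to\mathcal P^n_{X/k}(M)$, $m\mapsto 1\otimes m$, and let $\mathcal D^n_{X/k}(M)=\mathcal Hom_{\mathcal O_X}(\mathcal P^n_{X/k}(M),M)$ be the $\mathcal O_X$-module of differential operators of order at most $n$ on $M$, acting on $M$ by $P\cdot m=P(d^n m)$. Let $\mathrm{Ann}^nV\subset\mathcal D^n_{X/k}(M)$ be the submodule of those $P$ with $P\cdot v=0$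 for all $v\in V$, and let $W^n:\mathcal D^n_{X/k}(M)\to V^*\otimes_kM$ be the map that sends $P$ to the element corresponding to $v\mapsto P\cdot v$ under $V^*\otimes_kM=\mathrm{Hom}_k(V,M)$, where $V^*=\mathrm{Hom}_k(V,k)$. For $x\in X$ with residue field $k_x$ let $$d^n_V(x):k_x\otimes_kV\to k_x\otimes_{\mathcal O_{X,x}}\mathcal P^n_{X/k}(M)_x,\qquad c\otimes v\mapsto c\otimes d^n(v)_x.$$ Assume that $V$ is separated, i.e. for every $x\in X$ the map $d^n_V(x)$ is injective for all sufficiently large $n$. Let $n_{inj}(x)$ be the smallest $n\ge 0$ such that $d^n_V(x)$ is injective, and let $n_{inj}(V)=\sup_{x\in X}n_{inj}(x)$. Then for every integer $n\ge n_{inj}(V)$ the sequence of $\mathcal O_X$-modules $$0\to\mathrm{Ann}^nV\to\mathcal D^n_{X/k}(M)\xrightarrow{\;W^n\;}V^*\otimes_kM\to0$$ is exact, and it is locally split: every point of $X$ has an open neighbourhood $U$ such that the restriction of the sequence to $U$ is a split exact sequence of $\mathcal O_U$-modules. -/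

import Mathlib

open CategoryTheory AlgebraicGeometry TopologicalSpace Opposite
open scoped TensorProduct

universe u

noncomputable section

/-! ### Principal parts of algebras and modules -/

section Algebra

/-- The algebra `(R ⊗[k] R) ⧸ I ^ (n + 1)` of principal parts of order `n` of a `k`-algebra `R`,
where `I` is the kernel of the multiplication `R ⊗[k] R → R`. -/
def PrincipalParts (k R : Type*) [CommRing k] [CommRing R] [Algebra k R] (n : ℕ) : Type _ :=
  (R ⊗[k] R) ⧸ (KaehlerDifferential.ideal k R ^ (n + 1))

variable (k R S : Type*) [CommRing k] [CommRing R] [Algebra k R] [CommRing S] [Algebra k S] (n : ℕ)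

instance : CommRing (PrincipalParts k R n) :=
  inferInstanceAs (CommRing ((R ⊗[k] R) ⧸ (KaehlerDifferential.ideal k R ^ (n + 1))))

namespace PrincipalParts

/-- The projection `R ⊗[k] R → PrincipalParts k R n`. -/
def mk : R ⊗[k] R →+* PrincipalParts k R n :=
  Ideal.Quotient.mk (KaehlerDifferential.ideal k R ^ (n + 1))

/-- The structure map `r ↦ r ⊗ 1`. -/
def left : R →+* PrincipalParts k R n :=
  (mk k R n).comp (Algebra.TensorProduct.includeLeft : R →ₐ[k] R ⊗[k] R).toRingHom

/-- The structure map `r ↦ 1 ⊗ r`. -/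
def right : R →+* PrincipalParts k R n :=
  (mk k R n).comp (Algebra.TensorProduct.includeRight : R →ₐ[k] R ⊗[k] R).toRingHom

/-- As an `R`-algebra, `PrincipalParts k R n` is regarded through the *right* structure map;
this is the structure along which it is tensored with modules. -/
instance : Algebra R (PrincipalParts k R n) := (right k R n).toAlgebra

variable {k R S}

lemma left_algebraMap (c : k) :
    left k R n (algebraMap k R c) = right k R n (algebraMap k R c) := by
  simp only [left, right, RingHom.comp_apply]
  congr 1
  simp

/-- Functoriality of the principal parts in the algebra. -/
def map (φ : R →ₐ[k] S) : PrincipalParts k R n →+* PrincipalParts k S n :=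
  Ideal.quotientMap _ (Algebra.TensorProduct.map φ φ).toRingHom <| by
    rw [← Ideal.map_le_iff_le_comap, Ideal.map_pow]
    refine Ideal.pow_right_mono ?_ _
    rw [Ideal.map_le_iff_le_comap]
    intro x hx
    simp only [KaehlerDifferential.ideal, RingHom.mem_ker, Ideal.mem_comap] at hx ⊢
    have : ∀ y : R ⊗[k] R, Algebra.TensorProduct.lmul' (S := S) k (Algebra.TensorProduct.map φ φ y) =
        φ (Algebra.TensorProduct.lmul' (S := R) k y) := by
      intro y
      induction y with
      | zero => simp
      | tmul a b => simp
      | add a b ha hb => simp only [map_add, ha, hb]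
    exact (this x).trans (by rw [show Algebra.TensorProduct.lmul' (S := R) k x = 0 from hx, map_zero])

lemma map_mk (φ : R →ₐ[k] S) (x : R ⊗[k] R) :
    map n φ (mk k R n x) = mk k S n (Algebra.TensorProduct.map φ φ x) := rfl

lemma mk_surjective : Function.Surjective (mk k R n) := Ideal.Quotient.mk_surjective

@[simp]
lemma map_left (φ : R →ₐ[k] S) (r : R) : map n φ (left k R n r) = left k S n (φ r) := by
  simp [left, map_mk]

@[simp]
lemma map_right (φ : R →ₐ[k] S) (r : R) : map n φ (right k R n r) = right k S n (φ r) := by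
  simp [right, map_mk]

lemma map_id (x : PrincipalParts k R n) : map n (AlgHom.id k R) x = x := by
  obtain ⟨x, rfl⟩ := mk_surjective n x
  simp [map_mk]

lemma map_comp {T : Type*} [CommRing T] [Algebra k T] (φ : R →ₐ[k] S) (ψ : S →ₐ[k] T)
    (x : PrincipalParts k R n) : map n (ψ.comp φ) x = map n ψ (map n φ x) := by
  obtain ⟨x, rfl⟩ := mk_surjective n x
  simp only [map_mk]
  congr 1
  rw [← AlgHom.comp_apply, ← Algebra.TensorProduct.map_comp]

end PrincipalParts

/-- The module `PrincipalParts k R n ⊗[R] M` of principal parts of order `n` of an `R`-module `M`.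
The tensor product is formed with the right `R`-module structure of `PrincipalParts k R n`. -/
def ModulePrincipalParts (k R : Type*) [CommRing k] [CommRing R] [Algebra k R] (n : ℕ)
    (M : Type*) [AddCommGroup M] [Module R M] : Type _ :=
  PrincipalParts k R n ⊗[R] M

namespace ModulePrincipalParts

variable (M : Type*) [AddCommGroup M] [Module R M]

instance : AddCommGroup (ModulePrincipalParts k R n M) :=
  inferInstanceAs (AddCommGroup (PrincipalParts k R n ⊗[R] M))

instance : Module (PrincipalParts k R n) (ModulePrincipalParts k R n M) :=
  inferInstanceAs (Module (PrincipalParts k R n) (PrincipalParts k R n ⊗[R] M))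

/-- The `R`-module structure on `ModulePrincipalParts k R n M` comes from the left structure map
`R → PrincipalParts k R n`. -/
instance : Module R (ModulePrincipalParts k R n M) :=
  Module.compHom _ (PrincipalParts.left k R n)

variable {k R S M}

lemma smul_def (r : R) (x : ModulePrincipalParts k R n M) :
    r • x = PrincipalParts.left k R n r • x := rfl

/-- The pure tensor `p ⊗ m`. -/
def tmul (p : PrincipalParts k R n) (m : M) : ModulePrincipalParts k R n M := p ⊗ₜ[R] m

lemma smul_tmul (p q : PrincipalParts k R n) (m : M) :
    p • tmul n q m = tmul n (p * q) m := rfl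

lemma tmul_smul (p : PrincipalParts k R n) (r : R) (m : M) :
    tmul n p (r • m) = tmul n (PrincipalParts.right k R n r * p) m := by
  refine (TensorProduct.smul_tmul r p m).symm.trans ?_
  rw [Algebra.smul_def]; rfl

@[elab_as_elim]
lemma induction_on {P : ModulePrincipalParts k R n M → Prop} (x : ModulePrincipalParts k R n M)
    (zero : P 0) (tmul : ∀ p m, P (tmul n p m)) (add : ∀ x y, P x → P y → P (x + y)) : P x :=
  TensorProduct.induction_on x zero tmul add

variable {N : Type*} [AddCommGroup N] [Module S N]

/-- Functoriality of the module of principal parts: `p ⊗ m ↦ φ(p) ⊗ ψ(m)`. -/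
def map (φ : R →ₐ[k] S) (ψ : M →+ N) (h : ∀ (r : R) (m : M), ψ (r • m) = φ r • ψ m) :
    ModulePrincipalParts k R n M →+ ModulePrincipalParts k S n N :=
  TensorProduct.liftAddHom (R := R) (M := PrincipalParts k R n) (N := M)
    (AddMonoidHom.mk' (fun p ↦ AddMonoidHom.mk'
        (fun m ↦ tmul n (PrincipalParts.map n φ p) (ψ m))
        (fun m m' ↦ by rw [map_add]; exact TensorProduct.tmul_add _ _ _))
      (fun p p' ↦ by ext m; simp only [map_add]; exact TensorProduct.add_tmul _ _ _))
    (fun r p m ↦ by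
      simp only [AddMonoidHom.mk'_apply, h, tmul_smul, Algebra.smul_def, map_mul]
      congr 2
      exact PrincipalParts.map_right n φ r)

@[simp]
lemma map_tmul (φ : R →ₐ[k] S) (ψ : M →+ N) (h : ∀ (r : R) (m : M), ψ (r • m) = φ r • ψ m)
    (p : PrincipalParts k R n) (m : M) :
    map n φ ψ h (tmul n p m) = tmul n (PrincipalParts.map n φ p) (ψ m) := rfl

lemma map_smul (φ : R →ₐ[k] S) (ψ : M →+ N) (h : ∀ (r : R) (m : M), ψ (r • m) = φ r • ψ m)
    (r : R) (x : ModulePrincipalParts k R n M) :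
    map n φ ψ h (r • x) = φ r • map n φ ψ h x := by
  induction x using induction_on with
  | zero => simp
  | tmul p m => simp only [smul_def, smul_tmul, map_tmul, map_mul, PrincipalParts.map_left]
  | add x y hx hy => simp only [smul_add, map_add, hx, hy]

/-- The canonical map `M → PrincipalParts k R n ⊗[R] M`, `m ↦ 1 ⊗ m`. -/
def d (k R : Type*) [CommRing k] [CommRing R] [Algebra k R] (n : ℕ)
    (M : Type*) [AddCommGroup M] [Module R M] : M →+ ModulePrincipalParts k R n M :=
  AddMonoidHom.mk' (fun m ↦ tmul n 1 m) (fun _ _ ↦ TensorProduct.tmul_add _ _ _)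

lemma d_apply (m : M) : d k R n M m = tmul n 1 m := rfl

lemma map_d (φ : R →ₐ[k] S) (ψ : M →+ N) (h : ∀ (r : R) (m : M), ψ (r • m) = φ r • ψ m) (m : M) :
    map n φ ψ h (d k R n M m) = d k S n N (ψ m) := by
  simp [d_apply]

lemma d_smul (c : k) (m : M) :
    d k R n M (algebraMap k R c • m) = algebraMap k R c • d k R n M m := by
  simp only [d_apply, tmul_smul, smul_def, smul_tmul, PrincipalParts.left_algebraMap]

end ModulePrincipalParts

end Algebra

/-! ### The sheaf of principal parts -/

namespace AlgebraicGeometry.Scheme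

section OverField

variable (k : Type u) [Field k] {X : Scheme.{u}} [X.Over (Spec (CommRingCat.of k))]

/-- The ring homomorphism `k → Γ(X, U)` of a `k`-scheme `X`. -/
def fieldToSections (U : X.Opens) : k →+* Γ(X, U) :=
  ((Scheme.ΓSpecIso (CommRingCat.of k)).inv ≫ (X ↘ Spec (CommRingCat.of k)).appTop ≫
    X.presheaf.map (homOfLE le_top).op).hom

lemma map_fieldToSections {U W : X.Opens} (i : W ⟶ U) (c : k) :
    X.presheaf.map i.op (fieldToSections k U c) = fieldToSections k W c := by
  have h : X.presheaf.map (homOfLE (le_top : U ≤ ⊤)).op ≫ X.presheaf.map i.op =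
      X.presheaf.map (homOfLE (le_top : W ≤ ⊤)).op := by
    rw [← Functor.map_comp]; rfl
  exact congr($h ((X ↘ Spec (CommRingCat.of k)).appTop
    ((Scheme.ΓSpecIso (CommRingCat.of k)).inv c)))

instance algebraSections (U : X.Opens) : Algebra k Γ(X, U) := (fieldToSections k U).toAlgebra

instance moduleSections (M : X.Modules) (U : X.Opens) : Module k Γ(M, U) :=
  Module.compHom _ (fieldToSections k U)

instance isScalarTowerSections (M : X.Modules) (U : X.Opens) :
    IsScalarTower k Γ(X, U) Γ(M, U) :=
  ⟨fun c r m ↦ by rw [Algebra.smul_def, mul_smul]; rfl⟩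

/-- Restriction of functions as a homomorphism of `k`-algebras. -/
def resAlgHom {U W : X.Opens} (i : W ⟶ U) : Γ(X, U) →ₐ[k] Γ(X, W) where
  __ := (X.presheaf.map i.op).hom
  commutes' c := map_fieldToSections k i c

/-- Restriction of sections of a sheaf of modules as a `k`-linear map. -/
def Modules.resₗ (M : X.Modules) {U W : X.Opens} (i : W ⟶ U) : Γ(M, U) →ₗ[k] Γ(M, W) where
  __ := (M.presheaf.map i.op).hom
  map_smul' c m := by
    refine (M.map_smul i (fieldToSections k U c) m).trans ?_
    rw [map_fieldToSections]; rfl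

@[simp]
lemma Modules.resₗ_apply (M : X.Modules) {U W : X.Opens} (i : W ⟶ U) (m : Γ(M, U)) :
    M.resₗ k i m = M.presheaf.map i.op m := rfl

/-- The restriction maps `p ⊗ m ↦ p|_W ⊗ m|_W` of the modules of principal parts. -/
def principalPartsRes (M : X.Modules) (n : ℕ) {U W : X.Opens} (i : W ⟶ U) :
    ModulePrincipalParts k Γ(X, U) n Γ(M, U) →+ ModulePrincipalParts k Γ(X, W) n Γ(M, W) :=
  ModulePrincipalParts.map n (resAlgHom k i) (M.presheaf.map i.op).hom
    (fun r m ↦ M.map_smul i r m)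

lemma principalPartsRes_tmul (M : X.Modules) (n : ℕ) {U W : X.Opens} (i : W ⟶ U)
    (p : PrincipalParts k Γ(X, U) n) (m : Γ(M, U)) :
    principalPartsRes k M n i (ModulePrincipalParts.tmul n p m) =
      ModulePrincipalParts.tmul n (PrincipalParts.map n (resAlgHom k i) p)
        (M.presheaf.map i.op m) := rfl

lemma principalPartsRes_smul (M : X.Modules) (n : ℕ) {U W : X.Opens} (i : W ⟶ U) (r : Γ(X, U))
    (x : ModulePrincipalParts k Γ(X, U) n Γ(M, U)) :
    principalPartsRes k M n i (r • x) = X.presheaf.map i.op r • principalPartsRes k M n i x :=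
  ModulePrincipalParts.map_smul n (resAlgHom k i) (M.presheaf.map i.op).hom
    (fun r m ↦ M.map_smul i r m) r x

lemma principalPartsRes_id (M : X.Modules) (n : ℕ) (U : X.Opens)
    (x : ModulePrincipalParts k Γ(X, U) n Γ(M, U)) : principalPartsRes k M n (𝟙 U) x = x := by
  induction x using ModulePrincipalParts.induction_on with
  | zero => simp
  | tmul p m =>
    have h : resAlgHom k (𝟙 U) = AlgHom.id k Γ(X, U) := by
      ext x; exact congr($(X.presheaf.map_id (op U)) x)
    have h2 : M.presheaf.map (𝟙 U).op m = m := congr($(M.presheaf.map_id (op U)) m)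
    rw [principalPartsRes_tmul, h, PrincipalParts.map_id, h2]
  | add x y hx hy => rw [map_add, hx, hy]

lemma principalPartsRes_comp (M : X.Modules) (n : ℕ) {U W Z : X.Opens} (i : W ⟶ U) (j : Z ⟶ W)
    (x : ModulePrincipalParts k Γ(X, U) n Γ(M, U)) :
    principalPartsRes k M n (j ≫ i) x =
      principalPartsRes k M n j (principalPartsRes k M n i x) := by
  induction x using ModulePrincipalParts.induction_on with
  | zero => simp
  | tmul p m =>
    have h : resAlgHom k (j ≫ i) = (resAlgHom k j).comp (resAlgHom k i) := by
      ext x; exact congr($(X.presheaf.map_comp i.op j.op) x)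
    have h2 : M.presheaf.map (j ≫ i).op m = M.presheaf.map j.op (M.presheaf.map i.op m) :=
      congr($(M.presheaf.map_comp i.op j.op) m)
    simp only [principalPartsRes_tmul]
    rw [h, PrincipalParts.map_comp, h2]
  | add x y hx hy => rw [map_add, hx, hy, map_add, map_add]

/-- The presheaf of abelian groups
`U ↦ PrincipalParts k Γ(X, U) n ⊗[Γ(X, U)] Γ(M, U)`. -/
def principalPartsAb (M : X.Modules) (n : ℕ) : TopCat.Presheaf Ab.{u} X where
  obj U := AddCommGrpCat.of (ModulePrincipalParts k Γ(X, U.unop) n Γ(M, U.unop))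
  map i := AddCommGrpCat.ofHom (principalPartsRes k M n i.unop)
  map_id U := by ext x; exact principalPartsRes_id k M n U.unop x
  map_comp i j := by ext x; exact principalPartsRes_comp k M n i.unop j.unop x

instance modulePrincipalPartsAb (M : X.Modules) (n : ℕ) (U : X.Opensᵒᵖ) :
    Module (X.ringCatSheaf.obj.obj U) ((principalPartsAb k M n).obj U) :=
  inferInstanceAs (Module Γ(X, U.unop) (ModulePrincipalParts k Γ(X, U.unop) n Γ(M, U.unop)))

/-- The presheaf of modules `U ↦ PrincipalParts k Γ(X, U) n ⊗[Γ(X, U)] Γ(M, U)`, regarded as a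
module over `𝒪_X` through the left factor. -/
def principalPartsPresheaf (M : X.Modules) (n : ℕ) : X.PresheafOfModules :=
  PresheafOfModules.ofPresheaf (principalPartsAb k M n)
    (fun _ _ i r m ↦ principalPartsRes_smul k M n i.unop r m)

/-- The sheaf `𝒫ⁿ_{X/k}(M)` of principal parts of order `n` of an `𝒪_X`-module `M`. It is the
sheaf associated with `U ↦ PrincipalParts k Γ(X, U) n ⊗[Γ(X, U)] Γ(M, U)`; as the formation of
`PrincipalParts` commutes with filtered colimits, its stalk at `x` is
`(𝒪_{X,x} ⊗[k] 𝒪_{X,x} ⧸ I ^ (n + 1)) ⊗ M_x`, so that this is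
`Δ⁻¹(𝒪_{X × X}) ⧸ I_Δ ^ (n + 1) ⊗ M`. -/
def principalParts (M : X.Modules) (n : ℕ) : X.Modules :=
  (PresheafOfModules.sheafification (𝟙 X.ringCatSheaf.obj)).obj (principalPartsPresheaf k M n)

/-- The canonical map from the presheaf to the sheaf of principal parts. -/
def toPrincipalParts (M : X.Modules) (n : ℕ) :
    principalPartsAb k M n ⟶ (principalParts k M n).presheaf :=
  toSheafify (Opens.grothendieckTopology X) (principalPartsAb k M n)

lemma toPrincipalParts_smul (M : X.Modules) (n : ℕ) (U : X.Opens) (r : Γ(X, U))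
    (p : ModulePrincipalParts k Γ(X, U) n Γ(M, U)) :
    (toPrincipalParts k M n).app (op U) (r • p) =
      r • ((toPrincipalParts k M n).app (op U) p : Γ(principalParts k M n, U)) := by
  have h := ((PresheafOfModules.sheafificationHomEquiv (𝟙 X.ringCatSheaf.obj)
    (P := principalPartsPresheaf k M n) (𝟙 _)).app (op U)).hom.map_smul r p
  have h0 := PresheafOfModules.toPresheaf_map_sheafificationHomEquiv_def (𝟙 X.ringCatSheaf.obj)
    (P := principalPartsPresheaf k M n) (𝟙 _)
  have h1 : ∀ q : ModulePrincipalParts k Γ(X, U) n Γ(M, U),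
      ((PresheafOfModules.sheafificationHomEquiv (𝟙 X.ringCatSheaf.obj)
    (P := principalPartsPresheaf k M n) (𝟙 _)).app (op U)).hom q =
      (toPrincipalParts k M n).app (op U) q := fun q ↦ congr(($h0).app (op U) q)
  exact (h1 (r • p)).symm.trans (h.trans (congrArg
    (fun t : Γ(principalParts k M n, U) ↦ r • t) (h1 p)))

/-- The canonical map `dⁿ : M → 𝒫ⁿ_{X/k}(M)`, `m ↦ 1 ⊗ m`, on sections over `U`; it is
`k`-linear. -/
def dSections (M : X.Modules) (n : ℕ) (U : X.Opens) : Γ(M, U) →ₗ[k] Γ(principalParts k M n, U) where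
  toFun m := (toPrincipalParts k M n).app (op U) (ModulePrincipalParts.d k Γ(X, U) n Γ(M, U) m)
  map_add' m m' := by
    rw [map_add]; exact map_add ((toPrincipalParts k M n).app (op U)).hom _ _
  map_smul' c m := by
    have := toPrincipalParts_smul k M n U (fieldToSections k U c)
      (ModulePrincipalParts.d k Γ(X, U) n Γ(M, U) m)
    refine Eq.trans ?_ this
    congr 1
    exact ModulePrincipalParts.d_smul n c m

lemma map_dSections (M : X.Modules) (n : ℕ) {U W : X.Opens} (i : W ⟶ U) (m : Γ(M, U)) :
    (principalParts k M n).presheaf.map i.op (dSections k M n U m) =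
      dSections k M n W (M.presheaf.map i.op m) := by
  have h := congr($((toPrincipalParts k M n).naturality i.op)
    (ModulePrincipalParts.d k Γ(X, U) n Γ(M, U) m))
  refine Eq.trans h.symm ?_
  exact congrArg ((toPrincipalParts k M n).app (op W)) (ModulePrincipalParts.map_d n
    (resAlgHom k i) (M.presheaf.map i.op).hom (fun r m ↦ M.map_smul i r m) m)

end OverField

end AlgebraicGeometry.Scheme

/-! ### The sheaf of homomorphisms of two sheaves of modules -/

namespace AlgebraicGeometry.Scheme.Modules

variable {X : Scheme.{u}}

lemma map_map (F : X.Modules) {U W Z : X.Opens} (i : W ⟶ U) (j : Z ⟶ W) (m : Γ(F, U)) :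
    F.presheaf.map j.op (F.presheaf.map i.op m) = F.presheaf.map (j ≫ i).op m :=
  congr($(F.presheaf.map_comp i.op j.op) m).symm

lemma map_id_apply (F : X.Modules) {U : X.Opens} (i : U ⟶ U) (m : Γ(F, U)) :
    F.presheaf.map i.op m = m :=
  congr($(F.presheaf.map_id (op U)) m)

lemma ring_map_map {U W Z : X.Opens} (i : W ⟶ U) (j : Z ⟶ W) (r : Γ(X, U)) :
    X.presheaf.map j.op (X.presheaf.map i.op r) = X.presheaf.map (j ≫ i).op r :=
  congr($(X.presheaf.map_comp i.op j.op) r).symm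

lemma existsUnique_gluing (F : X.Modules) {ι : Type u} (U : ι → X.Opens) (V : X.Opens)
    (hU : ∀ i, U i ≤ V) (hV : V ≤ iSup U) (s : ∀ i, Γ(F, U i))
    (hs : ∀ i j, F.presheaf.map (homOfLE (inf_le_left : U i ⊓ U j ≤ U i)).op (s i) =
      F.presheaf.map (homOfLE (inf_le_right : U i ⊓ U j ≤ U j)).op (s j)) :
    ∃! t : Γ(F, V), ∀ i, F.presheaf.map (homOfLE (hU i)).op t = s i :=
  TopCat.Sheaf.existsUnique_gluing' (C := Ab.{u}) ⟨F.presheaf, F.isSheaf⟩ U V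
    (fun i ↦ homOfLE (hU i)) hV s hs

lemma eq_of_locally_eq (F : X.Modules) {ι : Type u} (U : ι → X.Opens) (V : X.Opens)
    (hU : ∀ i, U i ≤ V) (hV : V ≤ iSup U) (s t : Γ(F, V))
    (h : ∀ i, F.presheaf.map (homOfLE (hU i)).op s = F.presheaf.map (homOfLE (hU i)).op t) :
    s = t :=
  TopCat.Sheaf.eq_of_locally_eq' (C := Ab.{u}) ⟨F.presheaf, F.isSheaf⟩ U V
    (fun i ↦ homOfLE (hU i)) hV s t h

variable (F G : X.Modules)

/-- The group `Hom(F|_U, G|_U)` of `𝒪_U`-linear homomorphisms of sheaves: families of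
homomorphisms `Γ(F, W) → Γ(G, W)`, for `W ⊆ U`, which are `Γ(X, W)`-linear and compatible with
restrictions. -/
def localHomSubgroup (U : X.Opens) : 
    AddSubgroup (∀ W : {W : X.Opens // W ≤ U}, Γ(F, W.1) →+ Γ(G, W.1)) where
  carrier := {φ |
    (∀ (W : X.Opens) (h : W ≤ U) (r : Γ(X, W)) (m : Γ(F, W)), φ ⟨W, h⟩ (r • m) = r • φ ⟨W, h⟩ m) ∧
    (∀ (W Z : X.Opens) (h : W ≤ U) (i : Z ⟶ W) (m : Γ(F, W)),
      φ ⟨Z, i.le.trans h⟩ (F.presheaf.map i.op m) = G.presheaf.map i.op (φ ⟨W, h⟩ m))}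
  add_mem' := by
    rintro φ ψ ⟨h1, h2⟩ ⟨h3, h4⟩
    refine ⟨fun W h r m ↦ ?_, fun W Z h i m ↦ ?_⟩
    · simp only [Pi.add_apply, AddMonoidHom.add_apply, h1, h3, smul_add]
    · simp only [Pi.add_apply, AddMonoidHom.add_apply, h2 W Z h, h4 W Z h, map_add]
  zero_mem' := by
    refine ⟨fun W h r m ↦ ?_, fun W Z h i m ↦ ?_⟩ <;> simp
  neg_mem' := by
    rintro φ ⟨h1, h2⟩
    refine ⟨fun W h r m ↦ ?_, fun W Z h i m ↦ ?_⟩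
    · simp only [Pi.neg_apply, AddMonoidHom.neg_apply, h1, smul_neg]
    · simp only [Pi.neg_apply, AddMonoidHom.neg_apply, h2 W Z h, map_neg]

/-- The type of `𝒪_U`-linear homomorphisms `F|_U ⟶ G|_U`. -/
def LocalHom (U : X.Opens) : Type u := localHomSubgroup F G U

instance (U : X.Opens) : AddCommGroup (LocalHom F G U) :=
  inferInstanceAs (AddCommGroup (localHomSubgroup F G U))

namespace LocalHom

variable {F G} {U : X.Opens}

/-- The action of a local homomorphism on sections over `W ⊆ U`. -/
def app (P : LocalHom F G U) (W : X.Opens) (h : W ≤ U) : Γ(F, W) →+ Γ(G, W) := P.1 ⟨W, h⟩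

lemma map_smul (P : LocalHom F G U) {W : X.Opens} (h : W ≤ U) (r : Γ(X, W)) (m : Γ(F, W)) :
    P.app W h (r • m) = r • P.app W h m := P.2.1 W h r m

lemma map_res (P : LocalHom F G U) {W Z : X.Opens} (h : W ≤ U) (i : Z ⟶ W) (m : Γ(F, W)) :
    P.app Z (i.le.trans h) (F.presheaf.map i.op m) = G.presheaf.map i.op (P.app W h m) :=
  P.2.2 W Z h i m

@[ext]
lemma ext {P Q : LocalHom F G U} (H : ∀ (W : X.Opens) (h : W ≤ U) (m : Γ(F, W)),
    P.app W h m = Q.app W h m) : P = Q :=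
  Subtype.ext (funext fun W ↦ AddMonoidHom.ext (H W.1 W.2))

/-- Multiplication of a local homomorphism `P` by a function: `(r • P)(m) = r • P(m)`. -/
instance : SMul Γ(X, U) (LocalHom F G U) where
  smul r P := ⟨fun W ↦ AddMonoidHom.mk' (fun m ↦ X.presheaf.map (homOfLE W.2).op r • P.app W.1 W.2 m)
    (fun m m' ↦ by rw [map_add, smul_add]), by
      refine ⟨fun W h s m ↦ ?_, fun W Z h i m ↦ ?_⟩
      · simp only [AddMonoidHom.mk'_apply]
        rw [map_smul, smul_comm]
      · simp only [AddMonoidHom.mk'_apply]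
        rw [map_res P h, Modules.map_smul, ring_map_map]
        rfl⟩

lemma smul_apply (r : Γ(X, U)) (P : LocalHom F G U) {W : X.Opens} (h : W ≤ U) (m : Γ(F, W)) :
    (r • P).app W h m = X.presheaf.map (homOfLE h).op r • P.app W h m := rfl

lemma add_apply (P Q : LocalHom F G U) {W : X.Opens} (h : W ≤ U) (m : Γ(F, W)) :
    (P + Q).app W h m = P.app W h m + Q.app W h m := rfl

instance : Module Γ(X, U) (LocalHom F G U) where
  one_smul P := by ext W h m; rw [smul_apply, map_one, one_smul]
  mul_smul r s P := by ext W h m; simp only [smul_apply, map_mul, mul_smul]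
  smul_zero r := by ext W h m; exact smul_zero _
  smul_add r P Q := by ext W h m; simp only [smul_apply, add_apply, smul_add]
  add_smul r s P := by ext W h m; simp only [smul_apply, add_apply, map_add, add_smul]
  zero_smul P := by
    ext W h m
    rw [smul_apply, map_zero, zero_smul]
    rfl

/-- Restriction of local homomorphisms. -/
def res {U W : X.Opens} (i : W ⟶ U) : LocalHom F G U →+ LocalHom F G W where
  toFun P := ⟨fun Z ↦ P.app Z.1 (Z.2.trans i.le), fun Z h ↦ P.2.1 Z (h.trans i.le),
    fun Z Z' h ↦ P.2.2 Z Z' (h.trans i.le)⟩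
  map_zero' := rfl
  map_add' _ _ := rfl

lemma res_apply {U W : X.Opens} (i : W ⟶ U) (P : LocalHom F G U) {Z : X.Opens} (h : Z ≤ W)
    (m : Γ(F, Z)) : (res i P).app Z h m = P.app Z (h.trans i.le) m := rfl

lemma res_smul {U W : X.Opens} (i : W ⟶ U) (r : Γ(X, U)) (P : LocalHom F G U) :
    res i (r • P) = X.presheaf.map i.op r • res i P := by
  ext Z h m
  simp only [res_apply, smul_apply, ring_map_map]
  rfl

end LocalHom

/-- The presheaf of abelian groups `U ↦ Hom(F|_U, G|_U)`. -/
def sheafHomAb : TopCat.Presheaf Ab.{u} X where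
  obj U := AddCommGrpCat.of (LocalHom F G U.unop)
  map i := AddCommGrpCat.ofHom (LocalHom.res i.unop)
  map_id _ := rfl
  map_comp _ _ := rfl

lemma sheafHomAb_isSheaf : (sheafHomAb F G).IsSheaf := by
  rw [TopCat.Presheaf.isSheaf_iff_isSheafUniqueGluing]
  intro ι U sf hsf
  let s : ∀ i, LocalHom F G (U i) := sf
  have hs : ∀ (i j : ι) (W : X.Opens) (hi : W ≤ U i) (hj : W ≤ U j) (m : Γ(F, W)),
      (s i).app W hi m = (s j).app W hj m := by
    intro i j W hi hj m
    exact congr(($(hsf i j) : LocalHom F G (U i ⊓ U j)).app W (le_inf hi hj) m)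
  have key : ∀ (W : X.Opens) (_ : W ≤ iSup U) (m : Γ(F, W)),
      ∃! t : Γ(G, W), ∀ i, G.presheaf.map (homOfLE (inf_le_left : W ⊓ U i ≤ W)).op t =
        (s i).app (W ⊓ U i) inf_le_right
          (F.presheaf.map (homOfLE (inf_le_left : W ⊓ U i ≤ W)).op m) := by
    intro W hW m
    refine G.existsUnique_gluing (fun i ↦ W ⊓ U i) W (fun i ↦ inf_le_left) ?_ _ ?_
    · rw [← inf_iSup_eq]; exact le_inf le_rfl hW
    · intro i j
      rw [← LocalHom.map_res, ← LocalHom.map_res, map_map, map_map]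
      exact hs i j _ _ _ _
  choose g hg hg' using key
  have huniq : ∀ (W : X.Opens) (hW : W ≤ iSup U) (m : Γ(F, W)) (t : Γ(G, W)),
      (∀ i, G.presheaf.map (homOfLE (inf_le_left : W ⊓ U i ≤ W)).op t =
        (s i).app (W ⊓ U i) inf_le_right
          (F.presheaf.map (homOfLE (inf_le_left : W ⊓ U i ≤ W)).op m)) → t = g W hW m :=
    fun W hW m t ht ↦ hg' W hW m t ht
  let P : LocalHom F G (iSup U) := ⟨fun W ↦ AddMonoidHom.mk' (g W.1 W.2) (fun m m' ↦ by
      refine (huniq W.1 W.2 _ _ fun i ↦ ?_).symm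
      rw [map_add, hg, hg, map_add, map_add]), by
    refine ⟨fun W hW r m ↦ ?_, fun W Z hW j m ↦ ?_⟩
    · refine (huniq W hW _ _ fun i ↦ ?_).symm
      simp only [AddMonoidHom.mk'_apply]
      rw [Modules.map_smul, hg, Modules.map_smul, LocalHom.map_smul]
    · refine (huniq Z (j.le.trans hW) _ _ fun i ↦ ?_).symm
      simp only [AddMonoidHom.mk'_apply]
      have e := congrArg (G.presheaf.map
        (homOfLE (inf_le_inf_right (U i) j.le : Z ⊓ U i ≤ W ⊓ U i)).op) (hg W hW m i)
      rw [← LocalHom.map_res, map_map, map_map] at e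
      rw [map_map, map_map]
      exact e⟩
  refine ⟨P, fun i ↦ ?_, fun Q hQ ↦ ?_⟩
  · refine LocalHom.ext (P := LocalHom.res (Opens.leSupr U i) P) (Q := s i) fun W hW m ↦ ?_
    refine (huniq W _ m _ fun j ↦ ?_).symm
    rw [← LocalHom.map_res]
    exact hs i j _ _ _ _
  · refine LocalHom.ext (P := Q) (Q := P) fun W hW m ↦ huniq W hW m _ fun i ↦ ?_
    have := congr(($(hQ i) : LocalHom F G (U i)).app (W ⊓ U i) inf_le_right
      (F.presheaf.map (homOfLE (inf_le_left : W ⊓ U i ≤ W)).op m))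
    rw [← LocalHom.map_res (Q : LocalHom F G (iSup U))]
    exact this

instance (U : X.Opensᵒᵖ) : Module (X.ringCatSheaf.obj.obj U) ((sheafHomAb F G).obj U) :=
  inferInstanceAs (Module Γ(X, U.unop) (LocalHom F G U.unop))

/-- The `𝒪_X`-module `ℋom(F, G)` of homomorphisms of two `𝒪_X`-modules, with sections
`Hom(F|_U, G|_U)` over `U`. -/
def sheafHom : X.Modules where
  val := PresheafOfModules.ofPresheaf (sheafHomAb F G)
    (fun _ _ i r P ↦ LocalHom.res_smul i.unop r P)
  isSheaf := sheafHomAb_isSheaf F G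

end AlgebraicGeometry.Scheme.Modules

/-! ### Differential operators and their action on a space of sections -/

namespace AlgebraicGeometry.Scheme

section OverField

variable (k : Type u) [Field k] {X : Scheme.{u}} [X.Over (Spec (CommRingCat.of k))]

/-- The `𝒪_X`-module `𝒟ⁿ_{X/k}(M) = ℋom(𝒫ⁿ_{X/k}(M), M)` of differential operators of order at
most `n` on `M`. -/
def diffOps (M : X.Modules) (n : ℕ) : X.Modules :=
  (principalParts k M n).sheafHom M

/-- The action `P · m = P(dⁿ m)` of a local differential operator on sections. -/
def act (M : X.Modules) (n : ℕ) {U : X.Opens} (P : (principalParts k M n).LocalHom M U) :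
    Γ(M, U) →ₗ[k] Γ(M, U) where
  toFun m := P.app U le_rfl (dSections k M n U m)
  map_add' m m' := by rw [map_add, map_add]
  map_smul' c m := by
    rw [map_smul]
    exact P.map_smul le_rfl (fieldToSections k U c) (dSections k M n U m)

lemma act_add (M : X.Modules) (n : ℕ) {U : X.Opens}
    (P Q : (principalParts k M n).LocalHom M U) (m : Γ(M, U)) :
    act k M n (P + Q) m = act k M n P m + act k M n Q m := rfl

lemma act_smul (M : X.Modules) (n : ℕ) {U : X.Opens} (r : Γ(X, U))
    (P : (principalParts k M n).LocalHom M U) (m : Γ(M, U)) :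
    act k M n (r • P) m = r • act k M n P m := by
  have h : X.presheaf.map (homOfLE (le_refl U)).op r = r := congr($(X.presheaf.map_id (op U)) r)
  refine (Modules.LocalHom.smul_apply r P le_rfl _).trans ?_
  rw [h]; rfl

lemma res_act (M : X.Modules) (n : ℕ) {U W : X.Opens} (i : W ⟶ U)
    (P : (principalParts k M n).LocalHom M U) (m : Γ(M, U)) :
    M.presheaf.map i.op (act k M n P m) =
      act k M n (Modules.LocalHom.res i P) (M.presheaf.map i.op m) := by
  refine (P.map_res le_rfl i _).symm.trans ?_
  rw [map_dSections]; rfl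

section Evaluation

variable {k} {M : X.Modules} (V : Submodule k Γ(M, ⊤)) (n : ℕ)

/-- The restriction to `U` of the sections in `V`. -/
def resTop (U : X.Opens) : V →ₗ[k] Γ(M, U) := (M.resₗ k (homOfLE le_top)).comp V.subtype

lemma map_resTop {U W : X.Opens} (i : W ⟶ U) (v : V) :
    M.presheaf.map i.op (resTop V U v) = resTop V W v :=
  M.map_map _ _ _

/-- The evaluation of a local differential operator on `V`, as a `k`-linear map
`V → Γ(M, U)`, `v ↦ P · v`. -/
def evalOn {U : X.Opens} (P : (principalParts k M n).LocalHom M U) : V →ₗ[k] Γ(M, U) :=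
  (act k M n P).comp (resTop V U)

/-- The sections over `U` of `Annⁿ V`: the differential operators `P` of order at most `n`
over `U` with `P · V = 0`. -/
def annSections (U : X.Opens) :
    Submodule Γ(X, U) ((principalParts k M n).LocalHom M U) where
  carrier := {P | ∀ v : V, act k M n P (resTop V U v) = 0}
  add_mem' h h' v := by rw [act_add, h v, h' v, add_zero]
  zero_mem' _ := rfl
  smul_mem' r P h v := by rw [act_smul, h v, smul_zero]

/-- Restriction of sections of `Annⁿ V`. -/
def annRes {U W : X.Opens} (i : W ⟶ U) : annSections V n U →+ annSections V n W where
  toFun P := ⟨Modules.LocalHom.res i P.1, fun v ↦ by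
    rw [← map_resTop V i, ← res_act, P.2 v, map_zero]⟩
  map_zero' := rfl
  map_add' _ _ := rfl

/-- The presheaf of abelian groups underlying `Annⁿ V`. -/
def annAb : TopCat.Presheaf Ab.{u} X where
  obj U := AddCommGrpCat.of (annSections V n U.unop)
  map i := AddCommGrpCat.ofHom (annRes V n i.unop)
  map_id _ := rfl
  map_comp _ _ := rfl

lemma annAb_isSheaf : (annAb V n).IsSheaf := by
  rw [TopCat.Presheaf.isSheaf_iff_isSheafUniqueGluing]
  intro ι U sf hsf
  let s : ∀ i, annSections V n (U i) := sf
  obtain ⟨P', hP, hP'⟩ := (TopCat.Presheaf.isSheaf_iff_isSheafUniqueGluing _).1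
    (Modules.sheafHomAb_isSheaf (principalParts k M n) M) U (fun i ↦ (s i).1)
    (fun i j ↦ congrArg Subtype.val (hsf i j))
  let P : (principalParts k M n).LocalHom M (iSup U) := P'
  have hPs : ∀ i, Modules.LocalHom.res (Opens.leSupr U i) P = (s i).1 := hP
  have hPV : ∀ v : V, act k M n P (resTop V (iSup U) v) = 0 := fun v ↦ by
    refine M.eq_of_locally_eq U (iSup U) (le_iSup U) le_rfl _ _ fun i ↦ ?_
    rw [res_act, map_resTop, map_zero]
    have := (s i).2 v
    rw [← hPs] at this
    exact this
  refine ⟨⟨P, hPV⟩, fun i ↦ Subtype.ext (hP i), fun Q hQ ↦ Subtype.ext ?_⟩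
  exact hP' _ fun i ↦ congrArg Subtype.val (hQ i)

instance (U : X.Opensᵒᵖ) : Module (X.ringCatSheaf.obj.obj U) ((annAb V n).obj U) :=
  inferInstanceAs (Module Γ(X, U.unop) (annSections V n U.unop))

/-- The `𝒪_X`-submodule `Annⁿ V = {P ∈ 𝒟ⁿ_{X/k}(M) | P · V = 0}` of `𝒟ⁿ_{X/k}(M)`. -/
def ann : X.Modules where
  val := PresheafOfModules.ofPresheaf (annAb V n)
    (fun _ _ i r P ↦ Subtype.ext (Modules.LocalHom.res_smul i.unop r P.1))
  isSheaf := annAb_isSheaf V n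

/-- The inclusion `Annⁿ V ⟶ 𝒟ⁿ_{X/k}(M)`. -/
def annι : ann V n ⟶ diffOps k M n :=
  ⟨PresheafOfModules.homMk
    { app := fun U ↦ AddCommGrpCat.ofHom (annSections V n U.unop).subtype.toAddMonoidHom }
    (fun _ _ _ ↦ rfl)⟩

/-- The sections over `U` of `V^* ⊗[k] M`. -/
def DualTensor (U : X.Opens) : Type u := Module.Dual k V ⊗[k] Γ(M, U)

namespace DualTensor

instance (U : X.Opens) : AddCommGroup (DualTensor V U) :=
  inferInstanceAs (AddCommGroup (Module.Dual k V ⊗[k] Γ(M, U)))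

instance (U : X.Opens) : Module k (DualTensor V U) :=
  inferInstanceAs (Module k (Module.Dual k V ⊗[k] Γ(M, U)))

/-- Functions act on `V^* ⊗[k] M` through the second factor: `r • (f ⊗ m) = f ⊗ (r • m)`. -/
instance (U : X.Opens) : Module Γ(X, U) (DualTensor V U) :=
  Module.compHom (Module.Dual k V ⊗[k] Γ(M, U))
    ((Module.End.lTensorAlgHom k Γ(M, U) (Module.Dual k V)).toRingHom.comp
      (Algebra.lsmul k k Γ(M, U)).toRingHom)

/-- The canonical map `V^* ⊗[k] M → Hom_k(V, M)`. -/
def toHom (U : X.Opens) : DualTensor V U →ₗ[k] V →ₗ[k] Γ(M, U) := dualTensorHom k V Γ(M, U)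

/-- The pure tensor `f ⊗ m`. -/
def tmul {U : X.Opens} (f : Module.Dual k V) (m : Γ(M, U)) : DualTensor V U := f ⊗ₜ[k] m

@[elab_as_elim]
lemma induction_on {U : X.Opens} {P : DualTensor V U → Prop} (t : DualTensor V U)
    (zero : P 0) (tmul : ∀ f m, P (tmul V f m)) (add : ∀ x y, P x → P y → P (x + y)) : P t :=
  TensorProduct.induction_on t zero tmul add

lemma toHom_tmul {U : X.Opens} (f : Module.Dual k V) (m : Γ(M, U)) (v : V) :
    toHom V U (tmul V f m) v = f v • m := rfl

lemma smul_tmul {U : X.Opens} (r : Γ(X, U)) (f : Module.Dual k V) (m : Γ(M, U)) :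
    r • tmul V f m = tmul V f (r • m) := rfl

lemma toHom_smul {U : X.Opens} (r : Γ(X, U)) (t : DualTensor V U) (v : V) :
    toHom V U (r • t) v = r • toHom V U t v := by
  induction t using induction_on with
  | zero => simp only [smul_zero, map_zero, LinearMap.zero_apply]
  | tmul f m => rw [smul_tmul, toHom_tmul, toHom_tmul, smul_comm]
  | add x y hx hy => simp only [smul_add, map_add, LinearMap.add_apply, hx, hy]

/-- Restriction of sections of `V^* ⊗[k] M`. -/
def res {U W : X.Opens} (i : W ⟶ U) : DualTensor V U →ₗ[k] DualTensor V W :=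
  (M.resₗ k i).lTensor (Module.Dual k V)

lemma toHom_res {U W : X.Opens} (i : W ⟶ U) (t : DualTensor V U) (v : V) :
    toHom V W (res V i t) v = M.presheaf.map i.op (toHom V U t v) := by
  induction t using induction_on with
  | zero => simp only [map_zero, LinearMap.zero_apply]
  | tmul f m => exact ((M.resₗ k i).map_smul (f v) m).symm
  | add x y hx hy => simp only [map_add, LinearMap.add_apply, hx, hy]

lemma res_id {U : X.Opens} (t : DualTensor V U) : res V (𝟙 U) t = t := by
  have h : M.resₗ k (𝟙 U) = LinearMap.id := LinearMap.ext fun m ↦ M.map_id_apply (𝟙 _) m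
  rw [res, h, LinearMap.lTensor_id]; rfl

lemma res_comp {U W Z : X.Opens} (i : W ⟶ U) (j : Z ⟶ W) (t : DualTensor V U) :
    res V (j ≫ i) t = res V j (res V i t) := by
  have h : M.resₗ k (j ≫ i) = (M.resₗ k j).comp (M.resₗ k i) :=
    LinearMap.ext fun m ↦ (M.map_map i j m).symm
  rw [res, h, LinearMap.lTensor_comp]; rfl

variable [FiniteDimensional k V]

lemma toHom_bijective (U : X.Opens) : Function.Bijective (toHom V U) := dualTensorHom_bijective

/-- The isomorphism `V^* ⊗[k] M ≃ Hom_k(V, M)`. -/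
def equivHom (U : X.Opens) : DualTensor V U ≃ₗ[k] (V →ₗ[k] Γ(M, U)) :=
  LinearEquiv.ofBijective (toHom V U) (toHom_bijective V U)

lemma ext {U : X.Opens} {s t : DualTensor V U} (h : ∀ v, toHom V U s v = toHom V U t v) : s = t :=
  (toHom_bijective V U).1 (LinearMap.ext h)

lemma toHom_equivHom_symm {U : X.Opens} (f : V →ₗ[k] Γ(M, U)) :
    toHom V U ((equivHom V U).symm f) = f := (equivHom V U).apply_symm_apply f

end DualTensor

/-- The presheaf of abelian groups `U ↦ V^* ⊗[k] Γ(M, U)`. -/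
def dualTensorAb : TopCat.Presheaf Ab.{u} X where
  obj U := AddCommGrpCat.of (DualTensor V U.unop)
  map i := AddCommGrpCat.ofHom (DualTensor.res V i.unop).toAddMonoidHom
  map_id U := by ext t; exact DualTensor.res_id V t
  map_comp i j := by ext t; exact DualTensor.res_comp V i.unop j.unop t

variable [FiniteDimensional k V]

lemma dualTensorAb_isSheaf : (dualTensorAb V).IsSheaf := by
  rw [TopCat.Presheaf.isSheaf_iff_isSheafUniqueGluing]
  intro ι U sf hsf
  let s : ∀ i, DualTensor V (U i) := sf
  have key : ∀ v : V, ∃! t : Γ(M, iSup U), ∀ i,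
      M.presheaf.map (homOfLE (le_iSup U i)).op t = DualTensor.toHom V (U i) (s i) v := by
    intro v
    refine M.existsUnique_gluing U _ (le_iSup U) le_rfl _ fun i j ↦ ?_
    rw [← DualTensor.toHom_res, ← DualTensor.toHom_res]
    exact congr(DualTensor.toHom V (U i ⊓ U j) $(hsf i j) v)
  choose g hg hg' using key
  let G : V →ₗ[k] Γ(M, iSup U) :=
    { toFun := g
      map_add' := fun v w ↦ (hg' _ _ fun i ↦ by rw [map_add, map_add, hg, hg]).symm
      map_smul' := fun c v ↦ (hg' _ _ fun i ↦ by
        have := (M.resₗ k (homOfLE (le_iSup U i))).map_smul c (g v)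
        simp only [Modules.resₗ_apply] at this
        rw [RingHom.id_apply, this, map_smul, hg]).symm }
  refine ⟨(DualTensor.equivHom V _).symm G, fun i ↦ ?_, fun t ht ↦ ?_⟩
  · refine DualTensor.ext V (s := DualTensor.res V (Opens.leSupr U i) _) (t := s i) fun v ↦ ?_
    rw [DualTensor.toHom_res, DualTensor.toHom_equivHom_symm]
    exact hg v i
  · let t' : DualTensor V (iSup U) := t
    refine DualTensor.ext V (s := t') fun v ↦ ?_
    rw [DualTensor.toHom_equivHom_symm]
    refine hg' v _ fun i ↦ ?_
    rw [← DualTensor.toHom_res]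
    exact congr(DualTensor.toHom V (U i) $(ht i) v)

instance (U : X.Opensᵒᵖ) : Module (X.ringCatSheaf.obj.obj U) ((dualTensorAb V).obj U) :=
  inferInstanceAs (Module Γ(X, U.unop) (DualTensor V U.unop))

lemma DualTensor.res_smul {U W : X.Opens} (i : W ⟶ U) (r : Γ(X, U)) (t : DualTensor V U) :
    DualTensor.res V i (r • t) = X.presheaf.map i.op r • DualTensor.res V i t := by
  refine DualTensor.ext V fun v ↦ ?_
  rw [toHom_res, toHom_smul, toHom_smul, Modules.map_smul, toHom_res]

/-- The `𝒪_X`-module `V^* ⊗[k] M`, with sections `V^* ⊗[k] Γ(M, U)` over `U`. -/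
def dualTensor : X.Modules where
  val := PresheafOfModules.ofPresheaf (dualTensorAb V)
    (fun _ _ i r t ↦ DualTensor.res_smul V i.unop r t)
  isSheaf := dualTensorAb_isSheaf V

/-- The map `𝒟ⁿ_{X/k}(M) → V^* ⊗[k] M` on sections over `U`: it takes `P` to the element
corresponding to the `k`-linear map `v ↦ P · v` under `V^* ⊗[k] M = Hom_k(V, M)`. -/
def evalSections (U : X.Opens) :
    (principalParts k M n).LocalHom M U →+ DualTensor V U where
  toFun P := (DualTensor.equivHom V U).symm (evalOn V n P)
  map_zero' := by rw [← map_zero (DualTensor.equivHom V U).symm]; rfl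
  map_add' P Q := by rw [← map_add]; rfl

lemma toHom_evalSections {U : X.Opens} (P : (principalParts k M n).LocalHom M U) (v : V) :
    DualTensor.toHom V U (evalSections V n U P) v = act k M n P (resTop V U v) :=
  congr($(DualTensor.toHom_equivHom_symm V (evalOn V n P)) v)

/-- The evaluation map `Wⁿ : 𝒟ⁿ_{X/k}(M) ⟶ V^* ⊗[k] M`. -/
def evalMap : diffOps k M n ⟶ dualTensor V :=
  ⟨PresheafOfModules.homMk
    { app := fun U ↦ AddCommGrpCat.ofHom (evalSections V n U.unop)
      naturality := fun U W i ↦ by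
        ext P
        let P' : (principalParts k M n).LocalHom M U.unop := P
        refine DualTensor.ext V (s := evalSections V n W.unop (Modules.LocalHom.res i.unop P'))
          (t := DualTensor.res V i.unop (evalSections V n U.unop P')) fun v ↦ ?_
        rw [toHom_evalSections, DualTensor.toHom_res, toHom_evalSections, res_act, map_resTop] }
    (fun U r P ↦ by
      let r' : Γ(X, U.unop) := r
      let P' : (principalParts k M n).LocalHom M U.unop := P
      refine DualTensor.ext V (s := evalSections V n U.unop (r' • P'))
          (t := r' • evalSections V n U.unop P') fun v ↦ ?_
      rw [toHom_evalSections, DualTensor.toHom_smul, toHom_evalSections, act_smul])⟩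

/-- The sequence `0 → Annⁿ V → 𝒟ⁿ_{X/k}(M) → V^* ⊗[k] M → 0` of `𝒪_X`-modules. -/
def evalSequence : ShortComplex X.Modules where
  X₁ := ann V n
  X₂ := diffOps k M n
  X₃ := dualTensor V
  f := annι V n
  g := evalMap V n
  zero := by
    apply Modules.hom_ext
    intro U
    ext P
    refine DualTensor.ext V (s := evalSections V n U (P : annSections V n U).1) (t := 0) fun v ↦ ?_
    rw [toHom_evalSections, map_zero]
    exact (P : annSections V n U).2 v

end Evaluation

end OverField

end AlgebraicGeometry.Scheme

/-! ### Fibres of the Taylor map, separated subspaces, injectivity order -/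

namespace AlgebraicGeometry.Scheme

section Fibre

variable {X : Scheme.{u}}

instance moduleStalk (F : X.Modules) (x : X) :
    Module (X.presheaf.stalk x) (F.presheaf.stalk x) :=
  let F' : _root_.PresheafOfModules.{u} (X.presheaf ⋙ forget₂ CommRingCat RingCat) := F.val
  inferInstanceAs (Module (X.presheaf.stalk x) ↑(TopCat.Presheaf.stalk F'.presheaf x))

instance algebraStalkResidueField (x : X) : Algebra (X.presheaf.stalk x) (X.residueField x) :=
  (X.residue x).hom.toAlgebra

/-- The germ at `x` of a section of an `𝒪_X`-module. -/
def Modules.germ (F : X.Modules) (U : X.Opens) (x : X) (hx : x ∈ U) :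
    Γ(F, U) →+ F.presheaf.stalk x := (TopCat.Presheaf.germ F.presheaf U x hx).hom

lemma Modules.germ_smul (F : X.Modules) (U : X.Opens) (x : X) (hx : x ∈ U) (r : Γ(X, U))
    (m : Γ(F, U)) : F.germ U x hx (r • m) = X.presheaf.germ U x hx r • F.germ U x hx m :=
  PresheafOfModules.germ_smul (R := X.presheaf) F.val x U hx r m

/-- The fibre `k_x ⊗_{𝒪_{X,x}} F_x` of an `𝒪_X`-module `F` at a point `x`. -/
def Modules.fibre (F : X.Modules) (x : X) : Type u :=
  X.residueField x ⊗[X.presheaf.stalk x] F.presheaf.stalk x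

instance (F : X.Modules) (x : X) : AddCommGroup (F.fibre x) :=
  inferInstanceAs (AddCommGroup (X.residueField x ⊗[X.presheaf.stalk x] F.presheaf.stalk x))

instance (F : X.Modules) (x : X) : Module (X.residueField x) (F.fibre x) :=
  inferInstanceAs (Module (X.residueField x)
    (X.residueField x ⊗[X.presheaf.stalk x] F.presheaf.stalk x))

variable (k : Type u) [Field k] [X.Over (Spec (CommRingCat.of k))]

instance algebraResidueField (x : X) : Algebra k (X.residueField x) :=
  ((X.residue x).hom.comp ((X.presheaf.germ ⊤ x trivial).hom.comp (fieldToSections k ⊤))).toAlgebra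

instance moduleFibre (F : X.Modules) (x : X) : Module k (F.fibre x) :=
  Module.compHom _ (algebraMap k (X.residueField x))

instance isScalarTowerFibre (F : X.Modules) (x : X) :
    IsScalarTower k (X.residueField x) (F.fibre x) :=
  ⟨fun c r m ↦ by rw [Algebra.smul_def, mul_smul]; rfl⟩

/-- The value at `x`, in the fibre of `F`, of a global section of an `𝒪_X`-module `F`. -/
def Modules.value (F : X.Modules) (x : X) : Γ(F, ⊤) →ₗ[k] F.fibre x where
  toFun m := (1 : X.residueField x) ⊗ₜ[X.presheaf.stalk x] F.germ ⊤ x trivial m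
  map_add' m m' := by rw [map_add]; exact TensorProduct.tmul_add _ _ _
  map_smul' c m := by
    have h : F.germ ⊤ x trivial (c • m) =
        X.presheaf.germ ⊤ x trivial (fieldToSections k ⊤ c) • F.germ ⊤ x trivial m :=
      F.germ_smul ⊤ x trivial _ m
    rw [h, ← TensorProduct.smul_tmul, Algebra.smul_def, mul_one, RingHom.id_apply]
    refine Eq.trans ?_ (TensorProduct.smul_tmul' (algebraMap k (X.residueField x) c) 1
      (F.germ ⊤ x trivial m)).symm
    rw [smul_eq_mul, mul_one]
    rfl

variable {k} {M : X.Modules} (V : Submodule k Γ(M, ⊤))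

/-- The map of fibres `dⁿ_V(x) : k_x ⊗[k] V → k_x ⊗ 𝒫ⁿ_{X/k}(M)_x`, `c ⊗ v ↦ c ⊗ dⁿ(v)_x`, of the
Taylor map at a point `x`. -/
def taylorFibre (n : ℕ) (x : X) :
    X.residueField x ⊗[k] V →ₗ[X.residueField x] (principalParts k M n).fibre x :=
  LinearMap.liftBaseChange (X.residueField x)
    (((principalParts k M n).value k x).comp ((dSections k M n ⊤).comp V.subtype))

/-- `V` is separated at `x` if the maps of fibres of the Taylor map at `x` are injective for all
sufficiently large `n`. -/
def IsSeparatedAt (x : X) : Prop :=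
  ∃ N : ℕ, ∀ n : ℕ, N ≤ n → Function.Injective (taylorFibre V n x)

/-- `V` is separated if it is separated at every point. -/
def IsSeparatedSubspace : Prop := ∀ x : X, IsSeparatedAt V x

/-- The injectivity order of `V` at `x`: the smallest `n` such that `dⁿ_V(x)` is injective
(and `⊤` if there is none). -/
def injOrderAt (x : X) : ℕ∞ :=
  ⨅ n ∈ {n : ℕ | Function.Injective (taylorFibre V n x)}, (n : ℕ∞)

/-- The injectivity order `n_inj(V)` of `V`: the supremum of the injectivity orders at the points
of `X`. -/
def injOrder : ℕ∞ := ⨆ x : X, injOrderAt V x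

end Fibre

/-- An `𝒪_X`-module is locally free of finite rank if it is locally isomorphic to `𝒪_X ^ r`. -/
def Modules.IsLocallyFreeOfFiniteRank {X : Scheme.{u}} (M : X.Modules) : Prop :=
  ∀ x : X, ∃ U : X.Opens, x ∈ U ∧ ∃ r : ℕ,
    Nonempty (M.restrict U.ι ≅
      (SheafOfModules.free (R := U.toScheme.ringCatSheaf) (ULift.{u} (Fin r)) : U.toScheme.Modules))

instance {X Y : Scheme.{u}} (f : X ⟶ Y) [IsOpenImmersion f] :
    (Modules.restrictFunctor f).PreservesZeroMorphisms where
  map_zero _ _ := rfl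

/-- A sequence of `𝒪_X`-modules is locally split if every point of `X` has an open neighbourhood
`U` such that the restriction of the sequence to `U` is a split sequence of `𝒪_U`-modules. -/
def Modules.IsLocallySplit {X : Scheme.{u}} (S : ShortComplex X.Modules) : Prop :=
  ∀ x : X, ∃ U : X.Opens, x ∈ U ∧ Nonempty (S.map (Modules.restrictFunctor U.ι)).Splitting

end AlgebraicGeometry.Scheme

end

/-!
Local splitness and exactness on the right both follow from sections of `Wⁿ` over a neighbourhood of
each point, that is, from lifts along `Wⁿ` of a frame of `V^* ⊗[k] M`. A regular local ring of
finite type over a field of characteristic zero is smooth, so `Ω_{X/k}` is locally free with a frame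
of differentials `df₁, …, df_d`, and the monomials in the increments `1 ⊗ fᵢ - fᵢ ⊗ 1` of degree at
most `n` give a frame of `𝒫ⁿ_{X/k}(M)`. Write the Taylor expansions `dⁿ v` of a basis of `V` in such
a frame. Injectivity of `dⁿ_V(x)` says that the rows of this matrix are linearly independent at `x`;
hence the matrix has a right inverse near `x`, whose columns are the differential operators with
prescribed values on the basis of `V`. Injectivity of `d^m_V(x)` for some `m ≤ n` is enough, because
`d^m` factors through `dⁿ` by truncation.
-/

section RegularLocalRing

open IsLocalRing

section Noetherian

variable {R : Type*} [CommRing R] [IsLocalRing R] [IsNoetherianRing R]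

theorem maximalIdeal_eq_bot_of_spanFinrank_eq_zero
    (h : (maximalIdeal R).spanFinrank = 0) : maximalIdeal R = ⊥ :=
  (Submodule.spanFinrank_eq_zero_iff_eq_bot (IsNoetherian.noetherian _)).1 h

theorem exists_maximalIdeal_eq_span_insert {f : R} (hf : f ∈ maximalIdeal R)
    (hf2 : f ∉ maximalIdeal R ^ 2) :
    ∃ t : Set R, t.Finite ∧ maximalIdeal R = Ideal.span (insert f t) ∧
      t.ncard + 1 ≤ (maximalIdeal R).spanFinrank := by
  let c : CotangentSpace R := (maximalIdeal R).toCotangent ⟨f, hf⟩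
  have hc : c ≠ 0 := fun h ↦ hf2 ((Ideal.toCotangent_eq_zero _ ⟨f, hf⟩).1 h)
  let L : Submodule (ResidueField R) (CotangentSpace R) := Submodule.span _ {c}
  let b := Module.finBasis (ResidueField R) (CotangentSpace R ⧸ L)
  choose g hg using fun i ↦
    (L.mkQ_surjective.comp (Ideal.toCotangent_surjective (maximalIdeal R))) (b i)
  have hspan : Submodule.span R (insert ⟨f, hf⟩ (Set.range g)) = ⊤ := by
    rw [← CotangentSpace.span_image_eq_top_iff, Set.image_insert_eq, Submodule.span_insert,
      ← Submodule.map_mkQ_eq_top, Submodule.map_span, ← Set.range_comp, ← Set.range_comp,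
      ← b.span_eq]
    exact congrArg (fun h ↦ Submodule.span _ (Set.range h)) (funext hg)
  refine ⟨Set.range fun i ↦ (g i : R), Set.finite_range _, ?_, ?_⟩
  · have := congrArg (Submodule.map (maximalIdeal R).subtype) hspan
    rw [Submodule.map_span, Submodule.map_top, Submodule.range_subtype, Set.image_insert_eq,
      ← Set.range_comp] at this
    exact this.symm
  · rw [spanFinrank_maximalIdeal_eq_finrank_cotangentSpace, ← L.finrank_quotient_add_finrank,
      finrank_span_singleton hc]
    gcongr
    simpa [Set.image_univ, Set.ncard_univ, Nat.card_eq_fintype_card] using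
        Set.ncard_image_le (f := fun i ↦ (g i : R)) Set.finite_univ

theorem spanFinrank_maximalIdeal_le_quotient {I : Ideal R} [IsLocalRing (R ⧸ I)]
    (hI : I ≤ maximalIdeal R ^ 2) :
    (maximalIdeal R).spanFinrank ≤ (maximalIdeal (R ⧸ I)).spanFinrank := by
  classical
  obtain ⟨s, hscard, hs⟩ :=
    (IsNoetherian.noetherian (maximalIdeal (R ⧸ I))).exists_span_finset_card_eq_spanFinrank
  let g := Function.surjInv (Ideal.Quotient.mk_surjective (I := I))
  have hg (y) : Ideal.Quotient.mk I (g y) = y := Function.surjInv_eq _ y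
  have hmap : (Ideal.span (g '' s)).map (Ideal.Quotient.mk I) = maximalIdeal (R ⧸ I) := by
    simpa only [Ideal.map_span, Set.image_image, hg, Set.image_id'] using hs
  have hm : Ideal.span (g '' s) ⊔ I = maximalIdeal R := by
    have := IsLocalHom.of_surjective (Ideal.Quotient.mk I) Ideal.Quotient.mk_surjective
    rw [← maximalIdeal_comap (Ideal.Quotient.mk I), ← hmap,
      Ideal.comap_map_of_surjective' _ Ideal.Quotient.mk_surjective, Ideal.mk_ker]
  have hle : maximalIdeal R ≤ Ideal.span (g '' s) :=
    Submodule.le_of_le_smul_of_le_jacobson_bot (IsNoetherian.noetherian _)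
      (maximalIdeal_le_jacobson _) (by
        rw [smul_eq_mul, ← sq]; exact hm.ge.trans (sup_le_sup_left hI _))
  rw [hle.antisymm (le_sup_left.trans hm.le), ← hscard]
  refine (Submodule.spanFinrank_span_le_ncard_of_finite (s.finite_toSet.image g)).trans ?_
  exact (Set.ncard_image_le s.finite_toSet).trans_eq (Set.ncard_coe_finset s)

end Noetherian

variable {R : Type*} [CommRing R] [IsRegularLocalRing R]

theorem isRegularLocalRing_quotient_span_singleton {f : R} (hf : f ∈ maximalIdeal R)
    (hf2 : f ∉ maximalIdeal R ^ 2) :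
    ∃ _ : IsRegularLocalRing (R ⧸ Ideal.span {f}),
      (maximalIdeal (R ⧸ Ideal.span {f})).spanFinrank + 1 = (maximalIdeal R).spanFinrank := by
  obtain ⟨t, ht, hspan, htc⟩ := exists_maximalIdeal_eq_span_insert hf hf2
  let π := Ideal.Quotient.mk (Ideal.span {f})
  have : Nontrivial (R ⧸ Ideal.span {f}) := Ideal.Quotient.nontrivial_iff.2 fun h ↦
    (mem_maximalIdeal _).1 hf (Ideal.span_singleton_eq_top.1 h)
  have : IsLocalRing (R ⧸ Ideal.span {f}) := .of_surjective' π Ideal.Quotient.mk_surjective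
  have hle : (maximalIdeal (R ⧸ Ideal.span {f})).spanFinrank + 1 ≤
      (maximalIdeal R).spanFinrank := by
    rw [← map_maximalIdeal_of_surjective π Ideal.Quotient.mk_surjective]
    conv_lhs => rw [hspan]
    rw [Ideal.map_span, Set.image_insert_eq,
      Ideal.Quotient.eq_zero_iff_mem.2 (Ideal.mem_span_singleton_self f), Ideal.span_insert_zero]
    refine le_trans ?_ htc
    gcongr
    exact (Submodule.spanFinrank_span_le_ncard_of_finite (ht.image π)).trans
      (Set.ncard_image_le ht)
  have hdim : (maximalIdeal R).spanFinrank ≤ ringKrullDim (R ⧸ Ideal.span {f}) + 1 := by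
    rw [IsRegularLocalRing.spanFinrank_maximalIdeal]
    have := ringKrullDim_le_ringKrullDim_quotient_add_card {f}
      (by simpa [ringJacobson_eq_maximalIdeal] using hf)
    rw [Finset.coe_singleton, Finset.card_singleton] at this
    exact_mod_cast this
  have hreg : IsRegularLocalRing (R ⧸ Ideal.span {f}) := by
    refine .of_spanFinrank_maximalIdeal_le _ <|
      ENat.WithBot.add_le_add_one_right_iff.1 (le_trans ?_ hdim)
    exact_mod_cast hle
  refine ⟨hreg, hle.antisymm ?_⟩
  rw [← hreg.spanFinrank_maximalIdeal] at hdim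
  exact_mod_cast hdim

theorem exists_mem_maximalIdeal_notMem_sq_notMem_minimalPrimes
    (h : (maximalIdeal R).spanFinrank ≠ 0) :
    ∃ x ∈ maximalIdeal R, x ∉ maximalIdeal R ^ 2 ∧ ∀ P ∈ minimalPrimes R, x ∉ P := by
  have hsq : ¬ maximalIdeal R ≤ maximalIdeal R ^ 2 := fun hle ↦ by
    have := Submodule.eq_bot_of_le_smul_of_le_jacobson_bot (maximalIdeal R) (maximalIdeal R)
      (IsNoetherian.noetherian _) (by simpa [sq] using hle) (maximalIdeal_le_jacobson _)
    exact h (by rw [this, Submodule.spanFinrank_bot])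
  have hmin : ∀ P ∈ minimalPrimes R, ¬ maximalIdeal R ≤ P := fun P hP hle ↦ by
    have := hP.1.1
    have hheight := maximalIdeal_height_eq_ringKrullDim (R := R)
    rw [hle.antisymm (le_maximalIdeal hP.1.1.ne_top), Ideal.height_eq_zero_iff.2 hP,
      ← IsRegularLocalRing.spanFinrank_maximalIdeal] at hheight
    exact h (by exact_mod_cast hheight.symm)
  by_contra! H
  obtain ⟨P, rfl | hP, hle⟩ := (Ideal.subset_union_prime_finite (I := maximalIdeal R) (f := id)
    ((minimalPrimes.finite_of_isNoetherianRing R).insert (maximalIdeal R ^ 2))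
    (maximalIdeal R ^ 2) (maximalIdeal R ^ 2)
    (fun P hP hne _ ↦ (hP.resolve_left hne).1.1)).1 fun y hy ↦ by
      by_cases hy2 : y ∈ maximalIdeal R ^ 2
      · exact Set.mem_biUnion (Set.mem_insert _ _) hy2
      · obtain ⟨P, hP, hyP⟩ := H y hy hy2
        exact Set.mem_biUnion (Set.mem_insert_of_mem _ hP) hyP
  · exact hsq hle
  · exact hmin P hP hle

theorem isDomain_of_isRegularLocalRing (R : Type*) [CommRing R] [IsRegularLocalRing R] :
    IsDomain R := by
  induction hd : (maximalIdeal R).spanFinrank generalizing R with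
  | zero =>
    exact (isField_iff_maximalIdeal_eq.2 (maximalIdeal_eq_bot_of_spanFinrank_eq_zero hd)).isDomain
  | succ d ih =>
    obtain ⟨x, hx, hx2, hxmin⟩ :=
      exists_mem_maximalIdeal_notMem_sq_notMem_minimalPrimes (R := R) (by omega)
    obtain ⟨_, hrank⟩ := isRegularLocalRing_quotient_span_singleton hx hx2
    have hprime : (Ideal.span {x}).IsPrime :=
      (Ideal.Quotient.isDomain_iff_prime _).1 (ih (R ⧸ Ideal.span {x}) (by omega))
    obtain ⟨P, hP, hPx⟩ := Ideal.exists_minimalPrimes_le (bot_le (a := Ideal.span {x}))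
    have hPprime : P.IsPrime := hP.1.1
    -- `P ⊆ (x)` and `x ∉ P` give `P = x P`, so `P = 0` by Nakayama's lemma.
    have hPbot : P = ⊥ := by
      refine Submodule.eq_bot_of_le_smul_of_le_jacobson_bot (maximalIdeal R) P
        (IsNoetherian.noetherian _) (fun y hy ↦ ?_) (maximalIdeal_le_jacobson _)
      obtain ⟨a, rfl⟩ := Ideal.mem_span_singleton'.1 (hPx hy)
      rw [mul_comm]
      exact Submodule.smul_mem_smul hx ((hPprime.mem_or_mem hy).resolve_right (hxmin P hP))
    rw [hPbot] at hPprime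
    exact IsDomain.of_bot_isPrime R

theorem eq_bot_of_isRegularLocalRing_quotient {I : Ideal R} [hI : IsRegularLocalRing (R ⧸ I)]
    (hI2 : I ≤ maximalIdeal R ^ 2) : I = ⊥ := by
  by_contra hne
  obtain ⟨y, hyI, hy0⟩ := Submodule.exists_mem_ne_zero_of_ne_bot hne
  have := isDomain_of_isRegularLocalRing R
  have hdim : ringKrullDim (R ⧸ I) + 1 ≤ ringKrullDim R := calc
    _ ≤ ringKrullDim (R ⧸ Ideal.span {y}) + 1 := by
      gcongr
      exact ringKrullDim_le_of_surjective
        (Ideal.Quotient.factor ((Ideal.span_singleton_le_iff_mem I).2 hyI))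
        (Ideal.Quotient.factor_surjective _)
    _ ≤ ringKrullDim R :=
      ringKrullDim_quotient_succ_le_of_nonZeroDivisor (mem_nonZeroDivisors_of_ne_zero hy0)
  rw [← hI.spanFinrank_maximalIdeal, ← IsRegularLocalRing.spanFinrank_maximalIdeal] at hdim
  have hdim' : (maximalIdeal (R ⧸ I)).spanFinrank + 1 ≤ (maximalIdeal R).spanFinrank := by
    exact_mod_cast hdim
  have := spanFinrank_maximalIdeal_le_quotient hI2
  omega

theorem inf_maximalIdeal_sq_le_mul (R : Type*) [CommRing R] [IsRegularLocalRing R] (I : Ideal R)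
    [IsRegularLocalRing (R ⧸ I)] : I ⊓ maximalIdeal R ^ 2 ≤ maximalIdeal R * I := by
  induction hd : (maximalIdeal R).spanFinrank generalizing R with
  | zero => simp [maximalIdeal_eq_bot_of_spanFinrank_eq_zero hd]
  | succ d ih =>
    have hIm : I ≤ maximalIdeal R := le_maximalIdeal (Ideal.Quotient.nontrivial_iff.1 inferInstance)
    by_cases hI2 : I ≤ maximalIdeal R ^ 2
    · simp [eq_bot_of_isRegularLocalRing_quotient hI2]
    obtain ⟨f, hfI, hf2⟩ := Set.not_subset.1 hI2
    obtain ⟨_, hrank⟩ := isRegularLocalRing_quotient_span_singleton (hIm hfI) hf2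
    let π := Ideal.Quotient.mk (Ideal.span {f})
    have : IsRegularLocalRing ((R ⧸ Ideal.span {f}) ⧸ I.map π) :=
      .of_ringEquiv (DoubleQuot.quotQuotEquivQuotOfLE
        ((Ideal.span_singleton_le_iff_mem I).2 hfI)).symm
    have hquot := ih (R ⧸ Ideal.span {f}) (I.map π) (by omega)
    rw [← map_maximalIdeal_of_surjective π Ideal.Quotient.mk_surjective, ← Ideal.map_pow,
      ← Ideal.map_mul] at hquot
    intro y hy
    have hy' := hquot ⟨Ideal.mem_map_of_mem _ hy.1, Ideal.mem_map_of_mem _ hy.2⟩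
    rw [Ideal.mem_quotient_iff_mem_sup] at hy'
    obtain ⟨z, hz, w, hw, rfl⟩ := Submodule.mem_sup.1 hy'
    obtain ⟨a, rfl⟩ := Ideal.mem_span_singleton'.1 hw
    have haf : a * f ∈ maximalIdeal R ^ 2 :=
      (Submodule.add_mem_iff_right _ (sq (maximalIdeal R) ▸ Ideal.mul_mono_right hIm hz)).1 hy.2
    have ha : a ∈ maximalIdeal R := by
      by_contra hau
      obtain ⟨u, rfl⟩ := IsLocalRing.notMem_maximalIdeal.1 hau
      exact hf2 ((Ideal.unit_mul_mem_iff_mem _ u.isUnit).1 haf)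
    exact add_mem hz (Ideal.mul_mem_mul ha hfI)

end RegularLocalRing

section Smooth

open IsLocalRing TensorProduct

theorem one_tmul_eq_zero_iff_of_surjective {P K N : Type*} [CommRing P] [CommRing K] [Algebra P K]
    [AddCommGroup N] [Module P N] (hK : Function.Surjective (algebraMap P K)) (y : N) :
    (1 : K) ⊗ₜ[P] y = 0 ↔ y ∈ RingHom.ker (algebraMap P K) • (⊤ : Submodule P N) := by
  let e : (P ⧸ RingHom.ker (algebraMap P K)) ≃ₐ[P] K :=
    Ideal.quotientKerAlgEquivOfSurjective (f := Algebra.ofId P K) hK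
  rw [← LinearMap.ker_tensorProductMk, LinearMap.mem_ker, TensorProduct.mk_apply,
    ← (e.toLinearEquiv.rTensor N).map_eq_zero_iff, LinearEquiv.rTensor_tmul]
  simp

-- The conormal sequence: `R` is smooth over `k` as soon as `K ⊗ J → K ⊗ Ω[P⁄k]` is injective, where
-- `J = ker (P → R)` and `K` is the residue field. Smoothness of `K` over `k` gives this injectivity
-- for `m ⊇ J` in place of `J`, and `J ∩ m² ⊆ m J` allows us to go from `m` to `J`.
theorem formallySmooth_of_isRegularLocalRing_of_surjective (k P R : Type*) [Field k] [CommRing P]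
    [CommRing R] [Algebra k P] [Algebra k R] [Algebra P R] [IsScalarTower k P R]
    [IsRegularLocalRing P] [IsRegularLocalRing R] [Algebra.FormallySmooth k P]
    [Module.Finite P Ω[P⁄k]] (hPR : Function.Surjective (algebraMap P R))
    [Algebra.FormallySmooth k (ResidueField R)] : Algebra.FormallySmooth k R := by
  let K := ResidueField R
  have : IsScalarTower k P K := .to₁₂₄ k P R K
  have hPK : Function.Surjective (algebraMap P K) := residue_surjective.comp hPR
  have : Module.Free P Ω[P⁄k] := Module.free_of_flat_of_isLocalRing
  have hker : RingHom.ker (algebraMap P K) = maximalIdeal P :=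
    eq_maximalIdeal (RingHom.ker_isMaximal_of_surjective _ hPK)
  have hle : RingHom.ker (algebraMap P R) ≤ RingHom.ker (algebraMap P K) := fun y hy ↦ by
    rw [RingHom.mem_ker] at hy ⊢
    rw [IsScalarTower.algebraMap_apply P R K, hy, map_zero]
  have hinj := (Algebra.FormallySmooth.iff_injective_cotangentComplexBaseChange (R := k) (S := K)
    P K hPK (IsNoetherian.noetherian _) (by
      rw [isField_iff_maximalIdeal_eq.1 (Field.toIsField K)]; exact bot_le)).1 inferInstance
  rw [Algebra.FormallySmooth.iff_injective_cotangentComplexBaseChange_residueField P hPR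
    (IsNoetherian.noetherian _), injective_iff_map_eq_zero]
  intro z hz
  obtain ⟨y, rfl⟩ := TensorProduct.mk_surjective P _ K hPK z
  rw [TensorProduct.mk_apply] at hz ⊢
  have hzero : (1 : K) ⊗ₜ[P] (⟨y.1, hle y.2⟩ : RingHom.ker (algebraMap P K)) = 0 :=
    hinj (by rw [map_zero, ← hz]; rfl)
  rw [one_tmul_eq_zero_iff_of_surjective hPK, Submodule.mem_smul_top_iff] at hzero ⊢
  have hysq : y.1 ∈ maximalIdeal P ^ 2 := by rw [sq, ← hker]; exact hzero
  have : IsRegularLocalRing (P ⧸ RingHom.ker (algebraMap P R)) :=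
    .of_ringEquiv (RingHom.quotientKerEquivOfSurjective hPR).symm
  exact hker ▸ inf_maximalIdeal_sq_le_mul P _ ⟨y.2, hysq⟩

theorem isSmoothAt_of_isRegularLocalRing (k A : Type*) [Field k] [PerfectField k] [CommRing A]
    [Algebra k A] [Algebra.FiniteType k A] (p : Ideal A) [p.IsPrime]
    [IsRegularLocalRing (Localization.AtPrime p)] : Algebra.IsSmoothAt k p := by
  obtain ⟨n, f, hf⟩ := Algebra.FiniteType.iff_quotient_mvPolynomial''.1 ‹Algebra.FiniteType k A›
  let q := p.comap f.toRingHom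
  let P := Localization.AtPrime q
  let R := Localization.AtPrime p
  let φ : P →+* R := Localization.localRingHom q p f.toRingHom rfl
  have hφ : Function.Surjective φ := RingHom.surjectiveOnStalks_of_surjective hf p ‹_›
  let _ : Algebra P R := φ.toAlgebra
  have : IsScalarTower k P R := .of_algebraMap_eq fun x ↦ by
    rw [IsScalarTower.algebraMap_apply k (MvPolynomial (Fin n) k) P, RingHom.algebraMap_toAlgebra,
      Localization.localRingHom_to_map, IsScalarTower.algebraMap_apply k A R]
    exact congrArg _ (f.commutes x).symm
  have : Algebra.EssFiniteType k P := .comp k (MvPolynomial (Fin n) k) P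
  have : Algebra.EssFiniteType k R := .comp k A R
  have : Algebra.EssFiniteType k (ResidueField R) := .comp k R _
  have : Algebra.FormallySmooth k P := .comp k (MvPolynomial (Fin n) k) P
  exact formallySmooth_of_isRegularLocalRing_of_surjective k P R hφ

theorem exists_basis_kaehlerDifferential_of_isRegularLocalRing (k A : Type*) [Field k]
    [PerfectField k] [CommRing A] [Algebra k A] [Algebra.FiniteType k A] (p : Ideal A) [p.IsPrime]
    [IsRegularLocalRing (Localization.AtPrime p)] :
    ∃ g ∉ p, ∃ (d : ℕ) (b : Module.Basis (Fin d) (Localization.Away g) Ω[Localization.Away g⁄k])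
      (f : Fin d → Localization.Away g), ∀ i, b i = KaehlerDifferential.D k _ (f i) := by
  have := isSmoothAt_of_isRegularLocalRing k A p
  have : Algebra.FinitePresentation k A := Algebra.FinitePresentation.of_finiteType.1 inferInstance
  obtain ⟨g, hg, hstd⟩ := Algebra.IsSmoothAt.exists_notMem_isStandardSmooth k p
  obtain ⟨-, I, b, hb⟩ := Algebra.IsStandardSmooth.iff_exists_basis_kaehlerDifferential.1 hstd
  have : Nontrivial (Localization.Away g) := by
    have hu : IsUnit (algebraMap A (Localization.AtPrime p) g) :=
      IsLocalization.map_units (Localization.AtPrime p) (⟨g, hg⟩ : p.primeCompl)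
    exact (IsLocalization.Away.lift (S := Localization.Away g) g hu).domain_nontrivial
  have : Algebra.FiniteType k (Localization.Away g) := inferInstance
  have := Module.Finite.finite_basis b
  choose f hf using fun i ↦ hb ⟨i, rfl⟩
  exact ⟨g, hg, Nat.card I, b.reindex (Finite.equivFin I), f ∘ (Finite.equivFin I).symm,
    fun i ↦ by simp [hf]⟩

end Smooth

section Diagonal

open MvPolynomial KaehlerDifferential

theorem derivation_apply_mem_pow {A B : Type*} [CommRing A] [CommRing B] [Algebra A B]
    (δ : Derivation A B B) (I : Ideal B) (n : ℕ) {x : B} (hx : x ∈ I ^ (n + 1)) : δ x ∈ I ^ n := by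
  induction n generalizing x with
  | zero => simp
  | succ n ih =>
    rw [pow_succ'] at hx
    induction hx using Submodule.mul_induction_on' with
    | mem_mul_mem a ha b hb =>
      rw [δ.leibniz, smul_eq_mul, smul_eq_mul]
      refine add_mem ?_ (Ideal.mul_mem_right _ _ hb)
      rw [pow_succ']
      exact Ideal.mul_mem_mul ha (ih hb)
    | add a _ b _ ha hb => rw [map_add]; exact add_mem ha hb

variable {k R : Type*} [CommRing k] [CommRing R] [Algebra k R]

/-- The `R`-linear extension `a ⊗ b ↦ a ⊗ δ b` of a `k`-derivation `δ` of `R` to a derivation of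
`R ⊗[k] R`, that is, `δ` acting on the second factor. -/
noncomputable def lTensorDerivation (δ : Derivation k R R) :
    Derivation R (R ⊗[k] R) (R ⊗[k] R) :=
  .mk' (TensorProduct.AlgebraTensorModule.map (LinearMap.id : R →ₗ[R] R) δ.toLinearMap) <| by
    intro x y
    induction x with
    | zero => simp
    | add x x' hx hx' => simp only [add_mul, map_add, hx, hx', smul_eq_mul, mul_add]; ring
    | tmul a b =>
      induction y with
      | zero => simp
      | add y y' hy hy' => simp only [mul_add, map_add, hy, hy', smul_eq_mul, add_mul]; ring
      | tmul c d => simp [TensorProduct.tmul_add, mul_comm a c]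

theorem lTensorDerivation_tmul (δ : Derivation k R R) (a b : R) :
    lTensorDerivation δ (a ⊗ₜ b) = a ⊗ₜ δ b := rfl

variable (k) in
/-- The increment `1 ⊗ f - f ⊗ 1` of `f` along the diagonal. -/
def diagDiff (f : R) : R ⊗[k] R := 1 ⊗ₜ f - f ⊗ₜ 1

theorem diagDiff_mem_ideal (f : R) : diagDiff k f ∈ ideal k R :=
  one_smul_sub_smul_one_mem_ideal k f

theorem lTensorDerivation_diagDiff (δ : Derivation k R R) (f : R) :
    lTensorDerivation δ (diagDiff k f) = 1 ⊗ₜ δ f := by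
  simp [diagDiff, lTensorDerivation_tmul]

variable {ι : Type*} (f : ι → R)

variable (k) in
/-- Evaluation of polynomials with coefficients in `R ⊗ 1` at the increments `1 ⊗ f i - f i ⊗ 1`. -/
noncomputable def evalDiff : MvPolynomial ι R →ₐ[R] R ⊗[k] R := aeval fun i ↦ diagDiff k (f i)

theorem evalDiff_X (i : ι) : evalDiff k f (X i) = diagDiff k (f i) := aeval_X _ i

theorem lmul''_evalDiff (p : MvPolynomial ι R) :
    Algebra.TensorProduct.lmul'' k (evalDiff k f p) = constantCoeff p := by
  have : (Algebra.TensorProduct.lmul'' k).comp (evalDiff k f) = aeval (0 : ι → R) := by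
    ext i
    simp [evalDiff_X, diagDiff, Algebra.TensorProduct.lmul'']
  simpa [aeval_zero] using DFunLike.congr_fun this p

theorem lTensorDerivation_evalDiff [DecidableEq ι] {δ : Derivation k R R} {i : ι}
    (hδ : ∀ j, δ (f j) = if j = i then 1 else 0) (p : MvPolynomial ι R) :
    lTensorDerivation δ (evalDiff k f p) = evalDiff k f (pderiv i p) := by
  induction p using MvPolynomial.induction_on with
  | C a => rw [evalDiff, aeval_C, Derivation.map_algebraMap, pderiv_C, map_zero]
  | add p q hp hq => simp only [map_add, hp, hq]
  | mul_X p j hp =>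
    rw [map_mul, Derivation.leibniz, hp, evalDiff_X, lTensorDerivation_diagDiff, hδ, pderiv_mul,
      map_add, map_mul, map_mul, evalDiff_X, pderiv_X, Pi.single_apply, smul_eq_mul, smul_eq_mul]
    split_ifs with h
    · subst h
      simp [Algebra.TensorProduct.one_def, mul_comm, add_comm]
    · simp [mul_comm]

theorem coeff_eq_zero_of_evalDiff_mem_pow [IsAddTorsionFree R] (b : Module.Basis ι R Ω[R⁄k])
    (hb : ∀ i, b i = D k R (f i)) {n : ℕ} {p : MvPolynomial ι R}
    (hp : evalDiff k f p ∈ ideal k R ^ (n + 1)) {m : ι →₀ ℕ} (hm : m.degree ≤ n) :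
    p.coeff m = 0 := by
  classical
  by_cases hm0 : m = 0
  · have hker : Algebra.TensorProduct.lmul'' k (evalDiff k f p) = 0 :=
      Ideal.pow_le_self n.succ_ne_zero hp
    rwa [hm0, ← constantCoeff_eq, ← lmul''_evalDiff (k := k) f]
  -- For `i ∈ m.support`, apply the derivation `∂` of `R` with `∂ (f j) = δ i j` to the second
  -- factor.
  obtain ⟨i, hi⟩ := Finsupp.ne_iff.1 hm0
  obtain ⟨m, rfl⟩ : ∃ m', m = m' + Finsupp.single i 1 :=
    ⟨m - Finsupp.single i 1, (tsub_add_cancel_of_le (Finsupp.single_le_iff.2 (by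
      exact Nat.one_le_iff_ne_zero.2 hi))).symm⟩
  rw [map_add, Finsupp.degree_single] at hm
  obtain ⟨n, rfl⟩ : ∃ n', n = n' + 1 := ⟨n - 1, by omega⟩
  let δ : Derivation k R R := (b.coord i).compDer (D k R)
  have hδ : ∀ j, δ (f j) = if j = i then 1 else 0 := fun j ↦ by
    change b.coord i (D k R (f j)) = _
    rw [← hb, Module.Basis.coord_apply, Module.Basis.repr_self, Finsupp.single_apply]
  have hpderiv : evalDiff k f (pderiv i p) ∈ ideal k R ^ (n + 1) := by
    rw [← lTensorDerivation_evalDiff f hδ]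
    exact derivation_apply_mem_pow _ _ _ hp
  have hcoeff := coeff_eq_zero_of_evalDiff_mem_pow b hb hpderiv (m := m) (by omega)
  rw [coeff_pderiv, mul_comm, ← Nat.cast_succ, ← nsmul_eq_mul] at hcoeff
  exact (nsmul_eq_zero_iff_right (Nat.succ_ne_zero _)).1 hcoeff

theorem exists_isHomogeneous_one_sub_evalDiff_mem_sq (b : Module.Basis ι R Ω[R⁄k])
    (hb : ∀ i, b i = D k R (f i)) {x : R ⊗[k] R} (hx : x ∈ ideal k R) :
    ∃ p : MvPolynomial ι R, p.IsHomogeneous 1 ∧ x - evalDiff k f p ∈ ideal k R ^ 2 := by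
  let ω : Ω[R⁄k] := (ideal k R).toCotangent ⟨x, hx⟩
  let c := b.repr ω
  have heval : evalDiff k f (c.sum fun i r ↦ C r * X i) =
      (c.sum fun i r ↦ r • ⟨diagDiff k (f i), diagDiff_mem_ideal (f i)⟩ : ideal k R) := by
    simp [Finsupp.sum, evalDiff, Algebra.smul_def]
  refine ⟨c.sum fun i r ↦ C r * X i, .sum _ _ _ fun i _ ↦ ?_, ?_⟩
  · simpa using (isHomogeneous_C ι (c i)).mul (isHomogeneous_X R i)
  · rw [heval]
    refine (Ideal.toCotangent_eq _ (x := ⟨x, hx⟩)).1 ?_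
    rw [Finsupp.sum, map_sum]
    refine (b.linearCombination_repr ω).symm.trans (Finset.sum_congr rfl fun i _ ↦ ?_)
    change c i • b i = _
    rw [hb]
    rfl

theorem exists_isHomogeneous_sub_evalDiff_mem_pow (b : Module.Basis ι R Ω[R⁄k])
    (hb : ∀ i, b i = D k R (f i)) (n : ℕ) {x : R ⊗[k] R} (hx : x ∈ ideal k R ^ n) :
    ∃ p : MvPolynomial ι R, p.IsHomogeneous n ∧ x - evalDiff k f p ∈ ideal k R ^ (n + 1) := by
  induction n generalizing x with
  | zero =>
    refine ⟨C (Algebra.TensorProduct.lmul'' k x), isHomogeneous_C _ _, ?_⟩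
    change x - _ ∈ ideal k R ^ 1
    rw [pow_one]
    change Algebra.TensorProduct.lmul'' k _ = 0
    rw [map_sub, lmul''_evalDiff, constantCoeff_C, sub_self]
  | succ n ih =>
    rw [pow_succ] at hx
    induction hx using Submodule.mul_induction_on' with
    | mem_mul_mem u hu v hv =>
      obtain ⟨p, hp, hup⟩ := ih hu
      obtain ⟨q, hq, hvq⟩ := exists_isHomogeneous_one_sub_evalDiff_mem_sq f b hb hv
      have hpmem : evalDiff k f p ∈ ideal k R ^ n := by
        simpa using sub_mem hu (Ideal.pow_le_pow_right n.le_succ hup)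
      refine ⟨p * q, hp.mul hq, ?_⟩
      rw [map_mul, show u * v - evalDiff k f p * evalDiff k f q =
        (u - evalDiff k f p) * v + evalDiff k f p * (v - evalDiff k f q) by ring]
      refine add_mem (pow_succ (ideal k R) (n + 1) ▸ Ideal.mul_mem_mul hup hv) ?_
      exact pow_add (ideal k R) n 2 ▸ Ideal.mul_mem_mul hpmem hvq
    | add u _ v _ hu hv =>
      obtain ⟨p, hp, hup⟩ := hu
      obtain ⟨q, hq, hvq⟩ := hv
      exact ⟨p + q, hp.add hq, by rw [map_add, add_sub_add_comm]; exact add_mem hup hvq⟩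

theorem exists_degree_le_sub_evalDiff_mem_pow (b : Module.Basis ι R Ω[R⁄k])
    (hb : ∀ i, b i = D k R (f i)) (n : ℕ) (x : R ⊗[k] R) :
    ∃ p : MvPolynomial ι R, (∀ m ∈ p.support, m.degree ≤ n) ∧
      x - evalDiff k f p ∈ ideal k R ^ (n + 1) := by
  classical
  have hdegree {n : ℕ} {p : MvPolynomial ι R} (hp : p.IsHomogeneous n) {m : ι →₀ ℕ}
      (hm : m ∈ p.support) : m.degree = n := by
    rw [Finsupp.degree_eq_weight_one]
    exact hp (mem_support_iff.1 hm)
  induction n with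
  | zero =>
    obtain ⟨p, hp, hxp⟩ := exists_isHomogeneous_sub_evalDiff_mem_pow f b hb 0 (x := x) (by simp)
    exact ⟨p, fun m hm ↦ (hdegree hp hm).le, hxp⟩
  | succ n ih =>
    obtain ⟨p, hp, hxp⟩ := ih
    obtain ⟨q, hq, hxq⟩ := exists_isHomogeneous_sub_evalDiff_mem_pow f b hb (n + 1) hxp
    refine ⟨p + q, fun m hm ↦ ?_, by rwa [map_add, ← sub_sub]⟩
    rcases Finset.mem_union.1 (support_add hm) with hm | hm
    · exact (hp m hm).trans n.le_succ
    · exact (hdegree hq hm).le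

end Diagonal

section PrincipalPartsBasis

open MvPolynomial KaehlerDifferential

variable {k R : Type*} [CommRing k] [CommRing R] [Algebra k R] {ι : Type*} (f : ι → R)

variable (k) in
/-- The class of `∏ (1 ⊗ f i - f i ⊗ 1) ^ m i`: these classes, for `m` of degree at most `n`, are
the candidate basis of the algebra of principal parts over its left factor. -/
noncomputable def PrincipalParts.monomial (n : ℕ) (m : ι →₀ ℕ) : PrincipalParts k R n :=
  mk k R n (evalDiff k f (MvPolynomial.monomial m 1))

theorem PrincipalParts.map_monomial {S : Type*} [CommRing S] [Algebra k S] (φ : R →ₐ[k] S) (n : ℕ)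
    (m : ι →₀ ℕ) :
    map n φ (monomial k f n m) = monomial k (fun i ↦ φ (f i)) n m := by
  simp [monomial, map_mk, evalDiff, aeval_monomial, Finsupp.prod, diagDiff]

theorem PrincipalParts.mk_evalDiff (n : ℕ) {p : MvPolynomial ι R} {s : Finset (ι →₀ ℕ)}
    (hp : p.support ⊆ s) :
    mk k R n (evalDiff k f p) = ∑ m ∈ s, left k R n (p.coeff m) * monomial k f n m := by
  conv_lhs =>
    rw [p.as_sum, Finset.sum_subset hp fun m _ hm ↦ by rw [notMem_support_iff.1 hm, monomial_zero],
      map_sum, map_sum]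
  refine Finset.sum_congr rfl fun m _ ↦ ?_
  rw [monomial, left, RingHom.comp_apply, ← map_mul, ← mul_one (p.coeff m), ← smul_eq_mul,
    ← smul_monomial, map_smul, Algebra.smul_def, smul_eq_mul, mul_one]
  rfl

variable [Finite ι]

variable (ι) in
/-- The exponents of total degree at most `n`. -/
noncomputable def exponents (n : ℕ) : Finset (ι →₀ ℕ) :=
  (Finsupp.finite_of_degree_le (σ := ι) n).toFinset

theorem mem_exponents {n : ℕ} {m : ι →₀ ℕ} : m ∈ exponents ι n ↔ m.degree ≤ n := by
  simp [exponents]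

namespace ModulePrincipalParts

variable {M κ : Type*} [AddCommGroup M] [Module R M]

theorem tmul_sum {α : Type*} (n : ℕ) (p : PrincipalParts k R n) (s : Finset α) (m : α → M) :
    tmul n p (∑ a ∈ s, m a) = ∑ a ∈ s, tmul n p (m a) :=
  TensorProduct.tmul_sum _ _ _

theorem sum_tmul {α : Type*} (n : ℕ) (s : Finset α) (p : α → PrincipalParts k R n) (m : M) :
    tmul n (∑ a ∈ s, p a) m = ∑ a ∈ s, tmul n (p a) m :=
  TensorProduct.sum_tmul _ _ _

variable (k) in
/-- The elements `∏ (1 ⊗ f i - f i ⊗ 1) ^ m i ⊗ e l` of the module of principal parts, for `m` of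
degree at most `n`. -/
noncomputable def monomial (n : ℕ) (e : κ → M) (j : exponents ι n × κ) :
    ModulePrincipalParts k R n M :=
  tmul n (PrincipalParts.monomial k f n j.1) (e j.2)

theorem tmul_mk_evalDiff (n : ℕ) {p : MvPolynomial ι R} (hp : p.support ⊆ exponents ι n)
    (e : κ → M) (l : κ) :
    tmul n (PrincipalParts.mk k R n (evalDiff k f p)) (e l) =
      ∑ m, p.coeff m.1 • monomial k f n e (m, l) := by
  rw [PrincipalParts.mk_evalDiff f n hp, sum_tmul, ← Finset.sum_coe_sort]
  exact Finset.sum_congr rfl fun m _ ↦ by rw [smul_def, monomial, smul_tmul]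

theorem linearIndependent_monomial [IsAddTorsionFree R] [Finite κ] (b : Module.Basis ι R Ω[R⁄k])
    (hb : ∀ i, b i = D k R (f i)) (n : ℕ) (e : Module.Basis κ R M) :
    LinearIndependent R (monomial k f n e) := by
  classical
  have := Fintype.ofFinite κ
  rw [Fintype.linearIndependent_iff]
  intro g hg
  let p (l : κ) : MvPolynomial ι R := ∑ m : exponents ι n, MvPolynomial.monomial m.1 (g (m, l))
  have hcoeff (l : κ) (m : exponents ι n) : (p l).coeff m = g (m, l) := by
    simp [p, coeff_sum, coeff_monomial]
  have hsupport (l : κ) : (p l).support ⊆ exponents ι n :=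
    support_sum.trans (Finset.biUnion_subset.2 fun m _ ↦
      support_monomial_subset.trans (Finset.singleton_subset_iff.2 m.2))
  let E := Algebra.TensorProduct.basis (PrincipalParts k R n) e
  have hsum : ∑ l, PrincipalParts.mk k R n (evalDiff k f (p l)) • E l = 0 := by
    refine Eq.trans (Finset.sum_congr rfl fun l _ ↦ ?_)
      ((Fintype.sum_prod_type_right _).symm.trans hg)
    rw [Algebra.TensorProduct.basis_apply]
    refine (smul_tmul n _ 1 (e l)).trans ?_
    rw [mul_one, tmul_mk_evalDiff f n (hsupport l)]
    exact Finset.sum_congr rfl fun m _ ↦ by rw [hcoeff]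
  rintro ⟨m, l⟩
  rw [← hcoeff]
  exact coeff_eq_zero_of_evalDiff_mem_pow f b hb
    (Ideal.Quotient.eq_zero_iff_mem.1 <|
      Fintype.linearIndependent_iff.1 E.linearIndependent _ hsum l)
    (mem_exponents.1 m.2)

theorem span_monomial_eq_top [Finite κ] (b : Module.Basis ι R Ω[R⁄k])
    (hb : ∀ i, b i = D k R (f i)) (n : ℕ) (e : Module.Basis κ R M) :
    Submodule.span R (Set.range (monomial k f n e)) = ⊤ := by
  have := Fintype.ofFinite κ
  have hmem (q : PrincipalParts k R n) (l : κ) :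
      tmul n q (e l) ∈ Submodule.span R (Set.range (monomial k f n e)) := by
    obtain ⟨x, rfl⟩ := PrincipalParts.mk_surjective n q
    obtain ⟨p, hp, hxp⟩ := exists_degree_le_sub_evalDiff_mem_pow f b hb n x
    rw [show PrincipalParts.mk k R n x = PrincipalParts.mk k R n (evalDiff k f p) from
      Ideal.Quotient.eq.2 hxp, tmul_mk_evalDiff f n fun m hm ↦ mem_exponents.2 (hp m hm)]
    exact sum_mem fun m _ ↦ Submodule.smul_mem _ _ (Submodule.subset_span ⟨(m, l), rfl⟩)
  refine Submodule.eq_top_iff'.2 fun x ↦ ?_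
  induction x using ModulePrincipalParts.induction_on with
  | zero => exact zero_mem _
  | add x y hx hy => exact add_mem hx hy
  | tmul q m =>
    rw [← e.sum_repr m, tmul_sum]
    exact sum_mem fun l _ ↦ by rw [tmul_smul]; exact hmem _ l

/-- The basis of `∏ (1 ⊗ f i - f i ⊗ 1) ^ m i ⊗ e l` in the module of principal parts, when the
`df i` form a basis of the module of differentials and the `e l` form a basis of the module. -/
noncomputable def monomialBasis [IsAddTorsionFree R] [Finite κ] (b : Module.Basis ι R Ω[R⁄k])
    (hb : ∀ i, b i = D k R (f i)) (n : ℕ) (e : Module.Basis κ R M) :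
    Module.Basis (exponents ι n × κ) R (ModulePrincipalParts k R n M) :=
  .mk (linearIndependent_monomial f b hb n e) (span_monomial_eq_top f b hb n e).ge

theorem monomialBasis_apply [IsAddTorsionFree R] [Finite κ] (b : Module.Basis ι R Ω[R⁄k])
    (hb : ∀ i, b i = D k R (f i)) (n : ℕ) (e : Module.Basis κ R M) (j : exponents ι n × κ) :
    monomialBasis f b hb n e j = monomial k f n e j :=
  Module.Basis.mk_apply _ _ _

end ModulePrincipalParts

end PrincipalPartsBasis

section Frame

open AlgebraicGeometry.Scheme

variable {X : Scheme.{u}} {F G : X.Modules} {U : X.Opens} {J : Type*}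

/-- A family of sections of an `𝒪_X`-module over `U` is a frame if it restricts to a basis of the
module of sections over every open subset of `U`. -/
structure IsFrame (σ : J → Γ(F, U)) : Prop where
  linearIndependent {W : X.Opens} (h : W ≤ U) :
    LinearIndependent Γ(X, W) fun j ↦ F.presheaf.map (homOfLE h).op (σ j)
  span_eq_top {W : X.Opens} (h : W ≤ U) :
    Submodule.span Γ(X, W) (Set.range fun j ↦ F.presheaf.map (homOfLE h).op (σ j)) = ⊤

theorem isFrame_of_basis {σ : J → Γ(F, U)}
    (H : ∀ (W : X.Opens) (h : W ≤ U), ∃ b : Module.Basis J Γ(X, W) Γ(F, W),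
      ∀ j, b j = F.presheaf.map (homOfLE h).op (σ j)) : IsFrame σ where
  linearIndependent {W} h := by
    obtain ⟨b, hb⟩ := H W h
    exact funext hb ▸ b.linearIndependent
  span_eq_top {W} h := by
    obtain ⟨b, hb⟩ := H W h
    exact funext hb ▸ b.span_eq

theorem mem_span_of_locally_mem_span [Finite J] {τ : J → Γ(F, U)}
    (hτ : ∀ (W : X.Opens) (h : W ≤ U),
      LinearIndependent Γ(X, W) fun j ↦ F.presheaf.map (homOfLE h).op (τ j)) {s : Γ(F, U)}
    (hs : ∀ x ∈ U, ∃ (Z : X.Opens) (h : Z ≤ U), x ∈ Z ∧ F.presheaf.map (homOfLE h).op s ∈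
      Submodule.span Γ(X, Z) (Set.range fun j ↦ F.presheaf.map (homOfLE h).op (τ j))) :
    s ∈ Submodule.span Γ(X, U) (Set.range τ) := by
  have := Fintype.ofFinite J
  simp only [Submodule.mem_span_range_iff_exists_fun] at hs ⊢
  choose Z hZ hxZ a ha using fun x : U ↦ hs x x.2
  have hcover : U ≤ iSup Z := fun x hx ↦ Opens.mem_iSup.2 ⟨⟨x, hx⟩, hxZ _⟩
  have hagree (j : J) (x y : U) :
      X.presheaf.map (homOfLE (inf_le_left : Z x ⊓ Z y ≤ Z x)).op (a x j) =
        X.presheaf.map (homOfLE (inf_le_right : Z x ⊓ Z y ≤ Z y)).op (a y j) := by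
    revert j
    refine congrFun (linearIndependent_iff_injective_fintypeLinearCombination.1
      (hτ (Z x ⊓ Z y) (inf_le_left.trans (hZ x))) ?_)
    have hx := congrArg (F.presheaf.map (homOfLE (inf_le_left : Z x ⊓ Z y ≤ Z x)).op) (ha x)
    have hy := congrArg (F.presheaf.map (homOfLE (inf_le_right : Z x ⊓ Z y ≤ Z y)).op) (ha y)
    simp only [map_sum, Modules.map_smul, Modules.map_map, homOfLE_comp] at hx hy
    exact hx.trans hy.symm
  choose c hc _ using fun j ↦ X.sheaf.existsUnique_gluing' Z U (fun x ↦ homOfLE (hZ x)) hcover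
    (fun x ↦ a x j) fun x y ↦ hagree j x y
  refine ⟨c, F.eq_of_locally_eq Z U hZ hcover _ _ fun x ↦ ?_⟩
  rw [← ha x, map_sum]
  exact Finset.sum_congr rfl fun j _ ↦
    (F.map_smul _ _ _).trans (congrArg (· • F.presheaf.map (homOfLE (hZ x)).op (τ j)) (hc j x))

theorem isFrame_of_locally_mem_span [Finite J] {σ : J → Γ(F, U)}
    (hli : ∀ (W : X.Opens) (h : W ≤ U),
      LinearIndependent Γ(X, W) fun j ↦ F.presheaf.map (homOfLE h).op (σ j))
    (hspan : ∀ (W : X.Opens) (h : W ≤ U) (s : Γ(F, W)), ∀ x ∈ W, ∃ (Z : X.Opens) (h' : Z ≤ W),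
      x ∈ Z ∧ F.presheaf.map (homOfLE h').op s ∈
        Submodule.span Γ(X, Z) (Set.range fun j ↦ F.presheaf.map (homOfLE (h'.trans h)).op (σ j))) :
    IsFrame σ where
  linearIndependent {W} h := hli W h
  span_eq_top {W} h := by
    refine eq_top_iff.2 fun s _ ↦ mem_span_of_locally_mem_span (fun Z hZ ↦ ?_) fun x hx ↦ ?_
    · simpa only [Modules.map_map, homOfLE_comp] using hli Z (hZ.trans h)
    · simpa only [Modules.map_map, homOfLE_comp] using hspan W h s x hx

namespace IsFrame

variable {σ : J → Γ(F, U)}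

theorem restrict (hσ : IsFrame σ) {W : X.Opens} (h : W ≤ U) :
    IsFrame fun j ↦ F.presheaf.map (homOfLE h).op (σ j) where
  linearIndependent {Z} h' := by
    simpa only [Modules.map_map, homOfLE_comp] using hσ.linearIndependent (h'.trans h)
  span_eq_top {Z} h' := by
    simpa only [Modules.map_map, homOfLE_comp] using hσ.span_eq_top (h'.trans h)

/-- The basis of the module of sections over `W ⊆ U` obtained by restricting a frame. -/
noncomputable def basis (hσ : IsFrame σ) {W : X.Opens} (h : W ≤ U) :
    Module.Basis J Γ(X, W) Γ(F, W) :=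
  .mk (hσ.linearIndependent h) (hσ.span_eq_top h).ge

theorem basis_apply (hσ : IsFrame σ) {W : X.Opens} (h : W ≤ U) (j : J) :
    hσ.basis h j = F.presheaf.map (homOfLE h).op (σ j) :=
  Module.Basis.mk_apply _ _ _

theorem constr_basis_map (hσ : IsFrame σ) (c : J → Γ(G, U)) {W Z : X.Opens} (h : W ≤ U)
    (i : Z ⟶ W) (s : Γ(F, W)) :
    (hσ.basis (i.le.trans h)).constr Γ(X, Z)
        (fun j ↦ G.presheaf.map (homOfLE (i.le.trans h)).op (c j)) (F.presheaf.map i.op s) =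
      G.presheaf.map i.op
        ((hσ.basis h).constr Γ(X, W) (fun j ↦ G.presheaf.map (homOfLE h).op (c j)) s) := by
  induction (hσ.basis h).mem_span s using Submodule.span_induction with
  | mem s hs =>
    obtain ⟨j, rfl⟩ := hs
    have hj : F.presheaf.map i.op (hσ.basis h j) = hσ.basis (i.le.trans h) j := by
      rw [basis_apply, basis_apply, Modules.map_map]
      rfl
    rw [hj, Module.Basis.constr_basis, Module.Basis.constr_basis, Modules.map_map]
    rfl
  | zero => simp only [map_zero]
  | add s t _ _ hs ht => simp only [map_add, hs, ht]
  | smul r s _ hs => simp only [Modules.map_smul, _root_.map_smul, hs]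

/-- The homomorphism `F|_U ⟶ G|_U` with prescribed values on a frame of `F|_U`. -/
noncomputable def lift (hσ : IsFrame σ) (c : J → Γ(G, U)) : Modules.LocalHom F G U :=
  ⟨fun W ↦ ((hσ.basis W.2).constr Γ(X, W.1)
      fun j ↦ G.presheaf.map (homOfLE W.2).op (c j)).toAddMonoidHom,
    fun W h r s ↦ LinearMap.map_smul ((hσ.basis h).constr Γ(X, W) _) r s, fun _ _ h i s ↦
      hσ.constr_basis_map c h i s⟩

theorem lift_apply (hσ : IsFrame σ) (c : J → Γ(G, U)) (j : J) :
    (hσ.lift c).app U le_rfl (σ j) = c j := by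
  have h := (hσ.basis le_rfl).constr_basis Γ(X, U)
    (fun j ↦ G.presheaf.map (homOfLE le_rfl).op (c j)) j
  rwa [basis_apply, Modules.map_id_apply, Modules.map_id_apply] at h

theorem exists_eq_sum_smul [Fintype J] (hσ : IsFrame σ) (s : Γ(F, U)) :
    ∃ c : J → Γ(X, U), s = ∑ j, c j • σ j := by
  refine ⟨(hσ.basis le_rfl).equivFun s, ((hσ.basis le_rfl).sum_equivFun s).symm.trans ?_⟩
  simp only [basis_apply, Modules.map_id_apply]

end IsFrame

end Frame

section PrincipalPartsFrame

open AlgebraicGeometry.Scheme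

variable {k : Type u} [Field k] {X : Scheme.{u}} [X.Over (Spec (CommRingCat.of k))]
  {M : X.Modules} {n : ℕ}

variable (k M n) in
/-- The canonical map from the presheaf to the sheaf of principal parts, on sections over `U`, as a
`Γ(X, U)`-linear map. -/
noncomputable def principalPartsSection (U : X.Opens) :
    ModulePrincipalParts k Γ(X, U) n Γ(M, U) →ₗ[Γ(X, U)] Γ(principalParts k M n, U) where
  __ := ((toPrincipalParts k M n).app (op U)).hom
  map_smul' r p := toPrincipalParts_smul k M n U r p

theorem map_principalPartsSection {U W : X.Opens} (i : W ⟶ U)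
    (p : ModulePrincipalParts k Γ(X, U) n Γ(M, U)) :
    (principalParts k M n).presheaf.map i.op (principalPartsSection k M n U p) =
      principalPartsSection k M n W (principalPartsRes k M n i p) :=
  congr($((toPrincipalParts k M n).naturality i.op) p).symm

theorem exists_principalPartsSection_eq {U : X.Opens} (s : Γ(principalParts k M n, U)) {x : X}
    (hx : x ∈ U) : ∃ (W : X.Opens) (h : W ≤ U) (p : ModulePrincipalParts k Γ(X, W) n Γ(M, W)),
      x ∈ W ∧ principalPartsSection k M n W p =
        (principalParts k M n).presheaf.map (homOfLE h).op s := by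
  have h : Presheaf.IsLocallySurjective (Opens.grothendieckTopology X) (toPrincipalParts k M n) :=
    inferInstanceAs (Presheaf.IsLocallySurjective _ (toSheafify _ _))
  obtain ⟨W, i, ⟨p, hp⟩, hxW⟩ := h.imageSieve_mem s x hx
  exact ⟨W, i.le, p, hxW, hp⟩

theorem exists_principalPartsRes_eq_zero {U : X.Opens}
    {p : ModulePrincipalParts k Γ(X, U) n Γ(M, U)} (hp : principalPartsSection k M n U p = 0)
    {x : X} (hx : x ∈ U) :
    ∃ (W : X.Opens) (h : W ≤ U), x ∈ W ∧ principalPartsRes k M n (homOfLE h) p = 0 := by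
  have h : Presheaf.IsLocallyInjective (Opens.grothendieckTopology X) (toPrincipalParts k M n) :=
    inferInstanceAs (Presheaf.IsLocallyInjective _ (toSheafify _ _))
  obtain ⟨W, i, hi, hxW⟩ := h.equalizerSieve_mem (X := op U) p 0
    (hp.trans (map_zero (principalPartsSection k M n U)).symm) x hx
  exact ⟨W, i.le, hxW, Eq.trans hi (map_zero (principalPartsRes k M n i))⟩

variable {U : X.Opens} {J : Type*} [Finite J]
  {β : J → ModulePrincipalParts k Γ(X, U) n Γ(M, U)}

theorem linearIndependent_principalPartsSection
    (hβ : ∀ W ≤ U, ∀ x ∈ W, ∃ (Z : X.Opens) (_ : Z ≤ W) (h : Z ≤ U), x ∈ Z ∧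
      LinearIndependent Γ(X, Z) fun j ↦ principalPartsRes k M n (homOfLE h) (β j)) :
    LinearIndependent Γ(X, U) fun j ↦ principalPartsSection k M n U (β j) := by
  have := Fintype.ofFinite J
  refine Fintype.linearIndependent_iff.2 fun a ha j ↦ ?_
  simp only [← map_smul, ← map_sum] at ha
  have hloc (x : U) : ∃ (Z : X.Opens) (h : Z ≤ U), x.1 ∈ Z ∧
      X.presheaf.map (homOfLE h).op (a j) = 0 := by
    obtain ⟨W, hW, hxW, hres⟩ := exists_principalPartsRes_eq_zero ha x.2
    obtain ⟨Z, hZW, hZ, hxZ, hli⟩ := hβ W hW x hxW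
    refine ⟨Z, hZ, hxZ, Fintype.linearIndependent_iff.1 hli
      (fun j ↦ X.presheaf.map (homOfLE hZ).op (a j)) ?_ j⟩
    simp only [← principalPartsRes_smul, ← map_sum]
    rw [← homOfLE_comp hZW hW, principalPartsRes_comp, hres, map_zero]
  choose Z hZ hxZ hzero using hloc
  exact X.sheaf.eq_of_locally_eq' Z U (fun x ↦ homOfLE (hZ x))
    (fun x hx ↦ Opens.mem_iSup.2 ⟨⟨x, hx⟩, hxZ _⟩) (a j) 0
    fun x ↦ (hzero x).trans (map_zero (X.presheaf.map (homOfLE (hZ x)).op).hom).symm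

theorem isFrame_principalPartsSection
    (hβ : ∀ W ≤ U, ∀ x ∈ W, ∃ (Z : X.Opens) (_ : Z ≤ W) (h : Z ≤ U)
      (B : Module.Basis J Γ(X, Z) (ModulePrincipalParts k Γ(X, Z) n Γ(M, Z))),
      x ∈ Z ∧ ∀ j, B j = principalPartsRes k M n (homOfLE h) (β j)) :
    IsFrame fun j ↦ principalPartsSection k M n U (β j) := by
  refine isFrame_of_locally_mem_span (fun W hW ↦ ?_) fun W hW s x hx ↦ ?_
  · simp only [map_principalPartsSection]
    refine linearIndependent_principalPartsSection fun W' hW' x hx ↦ ?_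
    obtain ⟨Z, hZW, hZ, B, hxZ, hB⟩ := hβ W' (hW'.trans hW) x hx
    refine ⟨Z, hZW, hZW.trans hW', hxZ, ?_⟩
    simp only [← principalPartsRes_comp, homOfLE_comp, ← hB]
    exact B.linearIndependent
  · obtain ⟨N, hN, p, hxN, hp⟩ := exists_principalPartsSection_eq s hx
    obtain ⟨Z, hZN, hZ, B, hxZ, hB⟩ := hβ N (hN.trans hW) x hxN
    refine ⟨Z, hZN.trans hN, hxZ, ?_⟩
    rw [← homOfLE_comp hZN hN, ← Modules.map_map, ← hp]
    simp only [map_principalPartsSection, ← hB]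
    rw [Set.range_comp' (principalPartsSection k M n Z), Submodule.span_image, B.span_eq]
    exact Submodule.mem_map_of_mem trivial

end PrincipalPartsFrame

section LocallyFree

open AlgebraicGeometry.Scheme

variable {X : Scheme.{u}} {F G : X.Modules}

theorem presheaf_map_app (φ : F ⟶ G) {U W : X.Opens} (i : W ⟶ U) (s : Γ(F, U)) :
    G.presheaf.map i.op (φ.app U s) = φ.app W (F.presheaf.map i.op s) :=
  congr($(φ.mapPresheaf.naturality i.op) s).symm

theorem isFrame_ι_app_of_isBilimit {I : Type*} [Finite I] {U : X.Opens} {t : Γ(F, U)}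
    (ht : IsFrame fun _ : Unit ↦ t) {b : Limits.Bicone fun _ : I ↦ F} (hb : b.IsBilimit) :
    IsFrame fun i ↦ (b.ι i).app U t := by
  classical
  have := Fintype.ofFinite I
  have hπι (i j : I) (W : X.Opens) (s : Γ(F, W)) :
      (b.π j).app W ((b.ι i).app W s) = if i = j then s else 0 := by
    refine congr($(congrArg (fun φ : F ⟶ F ↦ φ.app W) (b.ι_π i j)) s).trans ?_
    split_ifs <;> rfl
  have htotal (W : X.Opens) (s : Γ(b.pt, W)) : ∑ i, (b.ι i).app W ((b.π i).app W s) = s := by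
    let evalAt : (b.pt ⟶ b.pt) →+ Γ(b.pt, W) :=
      AddMonoidHom.mk' (fun φ ↦ φ.app W s) fun _ _ ↦ rfl
    have h := congrArg evalAt (Limits.IsBilimit.total hb)
    rwa [map_sum] at h
  refine ⟨fun {W} h ↦ ?_, fun {W} h ↦ ?_⟩ <;> simp only [presheaf_map_app]
  · refine Fintype.linearIndependent_iff.2 fun a ha j ↦ ?_
    refine Fintype.linearIndependent_iff.1 (ht.linearIndependent h) (fun _ ↦ a j) ?_ ()
    simpa [hπι] using congrArg ((b.π j).app W) ha
  · refine eq_top_iff.2 fun s _ ↦ htotal W s ▸ sum_mem fun i _ ↦ ?_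
    have hmem : (b.π i).app W s ∈ Submodule.span Γ(X, W) (Set.range fun _ : Unit ↦
        F.presheaf.map (homOfLE h).op t) := ht.span_eq_top h ▸ trivial
    obtain ⟨r, hr⟩ := Submodule.mem_span_range_iff_exists_fun _ |>.1 hmem
    rw [← hr, map_sum]
    simp only [Modules.Hom.app_smul]
    exact sum_mem fun _ _ ↦ Submodule.smul_mem _ _ (Submodule.subset_span ⟨i, rfl⟩)

theorem exists_isFrame_unit (X : Scheme.{u}) :
    ∃ t : Γ((SheafOfModules.unit X.ringCatSheaf : X.Modules), ⊤), IsFrame fun _ : Unit ↦ t := by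
  refine ⟨(1 : Γ(X, ⊤)), isFrame_of_basis fun W h ↦ ?_⟩
  let b : Module.Basis Unit Γ(X, W) Γ(X, W) := .singleton Unit Γ(X, W)
  have hb (j : Unit) : b j = (X.presheaf.map (homOfLE h).op).hom 1 :=
    (Module.Basis.singleton_apply _ _ _).trans (map_one _).symm
  exact ⟨b, hb⟩

theorem exists_isFrame_of_iso_free {I : Type u} [Finite I]
    (φ : F ≅ (SheafOfModules.free (R := X.ringCatSheaf) I : X.Modules)) :
    ∃ e : I → Γ(F, ⊤), IsFrame e := by
  have := Fintype.ofFinite I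
  let c : Limits.Cofan (C := X.Modules) fun _ : I ↦ SheafOfModules.unit X.ringCatSheaf :=
    SheafOfModules.freeCofan I
  let ψ : c.pt ⟶ F := φ.inv
  have : IsIso ψ := φ.isIso_inv
  have hc : Limits.IsColimit (c.extend ψ) :=
    .extendIso ψ (SheafOfModules.isColimitFreeCofan (R := X.ringCatSheaf) I)
  obtain ⟨t, ht⟩ := exists_isFrame_unit X
  exact ⟨_, isFrame_ι_app_of_isBilimit ht (Limits.biconeIsBilimitOfColimitCoconeOfIsColimit hc)⟩

theorem isFrame_of_isFrame_restrict {U : X.Opens} {J : Type*} {e : J → Γ(F.restrict U.ι, ⊤)}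
    (he : IsFrame e) :
    IsFrame (F := F) fun j ↦ F.presheaf.map (eqToHom U.ι_image_top.symm).op (e j) := by
  refine isFrame_of_basis fun W h ↦ ?_
  obtain ⟨W, rfl⟩ : ∃ W' : U.toScheme.Opens, U.ι ''ᵁ W' = W :=
    ⟨U.ι ⁻¹ᵁ W, by rw [Scheme.Hom.image_preimage_eq_opensRange_inf, Opens.opensRange_ι,
      inf_eq_right.2 h]⟩
  let _ : Module Γ(X, U.ι ''ᵁ W) Γ(F.restrict U.ι, W) :=
    inferInstanceAs (Module Γ(X, U.ι ''ᵁ W) Γ(F, U.ι ''ᵁ W))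
  let b : Module.Basis J Γ(X, U.ι ''ᵁ W) Γ(F.restrict U.ι, W) :=
    (he.basis (le_top : W ≤ ⊤)).mapCoeffs
      (.refl Γ(X, U.ι ''ᵁ W) : Γ(U, W) ≃+* Γ(X, U.ι ''ᵁ W)) fun c s ↦ by
        change _ = (U.ι.appIso W).inv c • (s : Γ(F, U.ι ''ᵁ W))
        rw [Opens.ι_appIso]
        rfl
  have hb (j : J) : b j = (F.restrict U.ι).presheaf.map (homOfLE le_top).op (e j) :=
    (Module.Basis.mapCoeffs_apply ..).trans (he.basis_apply le_top j)
  have hmap (j : J) : F.presheaf.map (homOfLE h).op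
      (F.presheaf.map (eqToHom U.ι_image_top.symm).op (e j)) =
        (F.restrict U.ι).presheaf.map (homOfLE (le_top : W ≤ ⊤)).op (e j) :=
    F.map_map _ _ _
  exact ⟨b, fun j ↦ (hb j).trans (hmap j).symm⟩

theorem exists_isFrame_of_isLocallyFreeOfFiniteRank (hF : F.IsLocallyFreeOfFiniteRank) (x : X) :
    ∃ U : X.Opens, x ∈ U ∧ ∃ (J : Type u) (_ : Finite J) (e : J → Γ(F, U)), IsFrame e := by
  obtain ⟨U, hxU, r, ⟨φ⟩⟩ := hF x
  obtain ⟨e, he⟩ := exists_isFrame_of_iso_free φ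
  exact ⟨U, hxU, _, inferInstance, _, isFrame_of_isFrame_restrict he⟩

end LocallyFree

section PrincipalPartsOfRegular

theorem exists_basis_kaehlerDifferential_of_formallyEtale {k R S ι : Type*} [CommRing k]
    [CommRing R] [CommRing S] [Algebra k R] [Algebra k S] [Algebra R S] [IsScalarTower k R S]
    [Algebra.FormallyEtale R S] {f : ι → R} (b : Module.Basis ι R Ω[R⁄k])
    (hb : ∀ i, b i = KaehlerDifferential.D k R (f i)) :
    ∃ c : Module.Basis ι S Ω[S⁄k], ∀ i, c i = KaehlerDifferential.D k S (algebraMap R S (f i)) := by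
  refine ⟨(b.baseChange S).map (KaehlerDifferential.tensorKaehlerEquivOfFormallyEtale k R S),
    fun i ↦ ?_⟩
  rw [Module.Basis.map_apply, Module.Basis.baseChange_apply, hb,
    ← KaehlerDifferential.tensorKaehlerEquivOfFormallyEtale_symm_D_algebraMap,
    LinearEquiv.apply_symm_apply]

theorem exists_basis_kaehlerDifferential_of_isLocalization_away {k R S ι : Type*} [CommRing k]
    [CommRing R] [CommRing S] [Algebra k R] [Algebra k S] [Algebra R S] [IsScalarTower k R S]
    {g : R} [IsLocalization.Away g S] {f : ι → Localization.Away g}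
    (b : Module.Basis ι (Localization.Away g) Ω[Localization.Away g⁄k])
    (hb : ∀ i, b i = KaehlerDifferential.D k _ (f i)) :
    ∃ (f' : ι → S) (c : Module.Basis ι S Ω[S⁄k]), ∀ i, c i = KaehlerDifferential.D k S (f' i) := by
  let e := IsLocalization.algEquiv (Submonoid.powers g) (Localization.Away g) S
  let _ : Algebra (Localization.Away g) S := e.toRingEquiv.toRingHom.toAlgebra
  have : Algebra.FormallyEtale (Localization.Away g) S :=
    .of_equiv (A := Localization.Away g) { e.toRingEquiv with commutes' := fun _ ↦ rfl }
  have : IsScalarTower k (Localization.Away g) S :=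
    .of_algebraMap_eq fun c ↦ ((e.restrictScalars k).commutes c).symm
  exact ⟨_, exists_basis_kaehlerDifferential_of_formallyEtale b hb⟩

open AlgebraicGeometry.Scheme

variable (k : Type u) [Field k] {X : Scheme.{u}} [X.Over (Spec (CommRingCat.of k))]

theorem isScalarTower_basicOpen {U : X.Opens} (g : Γ(X, U)) :
    IsScalarTower k Γ(X, U) Γ(X, X.basicOpen g) :=
  .of_algebraMap_eq fun c ↦ (map_fieldToSections k (homOfLE (X.basicOpen_le g)) c).symm

theorem finiteType_sections [LocallyOfFiniteType (X ↘ Spec (CommRingCat.of k))] {U : X.Opens}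
    (hU : IsAffineOpen U) : Algebra.FiniteType k Γ(X, U) := by
  have hfin := (X ↘ Spec (CommRingCat.of k)).finiteType_appLE (isAffineOpen_top _) hU le_top
  have hmap : algebraMap k Γ(X, U) = ((X ↘ Spec (CommRingCat.of k)).appLE ⊤ U le_top).hom.comp
      (Scheme.ΓSpecIso (CommRingCat.of k)).commRingCatIsoToRingEquiv.symm.toRingHom := rfl
  rw [← RingHom.finiteType_algebraMap, hmap]
  exact hfin.comp (.of_surjective _ (RingEquiv.surjective _))

theorem exists_basis_kaehlerDifferential_sections [PerfectField k]
    [LocallyOfFiniteType (X ↘ Spec (CommRingCat.of k))] {x : X}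
    (hx : IsRegularLocalRing (X.presheaf.stalk x)) {N : X.Opens} (hxN : x ∈ N) :
    ∃ U ≤ N, x ∈ U ∧ IsAffineOpen U ∧ ∃ (d : ℕ) (f : Fin d → Γ(X, U))
      (b : Module.Basis (Fin d) Γ(X, U) Ω[Γ(X, U)⁄k]),
        ∀ i, b i = KaehlerDifferential.D k Γ(X, U) (f i) := by
  obtain ⟨U, hU, hxU, hUN⟩ := exists_isAffineOpen_mem_and_subset hxN
  have := finiteType_sections k hU
  let p := (hU.primeIdealOf ⟨x, hxU⟩).asIdeal
  let := X.presheaf.algebra_section_stalk ⟨x, hxU⟩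
  have hstalk : IsLocalization.AtPrime (X.presheaf.stalk x) p :=
    hU.isLocalization_stalk ⟨x, hxU⟩
  have : IsRegularLocalRing (Localization.AtPrime p) :=
    .of_ringEquiv (IsLocalization.algEquiv p.primeCompl (X.presheaf.stalk x)
      (Localization.AtPrime p)).toRingEquiv
  obtain ⟨g, hg, d, b, f, hb⟩ :=
    exists_basis_kaehlerDifferential_of_isRegularLocalRing k Γ(X, U) p
  have := hU.isLocalization_basicOpen g
  have := isScalarTower_basicOpen k g
  refine ⟨X.basicOpen g, (X.basicOpen_le g).trans hUN, ?_, hU.basicOpen g, d,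
    exists_basis_kaehlerDifferential_of_isLocalization_away (R := Γ(X, U)) b hb⟩
  rw [X.mem_basicOpen g x hxU]
  exact IsLocalization.map_units (M := p.primeCompl) (X.presheaf.stalk x) ⟨g, hg⟩

variable {k} {M : X.Modules}

theorem exists_basis_kaehlerDifferential_basicOpen {U : X.Opens} (hU : IsAffineOpen U) {ι : Type*}
    {f : ι → Γ(X, U)} (b : Module.Basis ι Γ(X, U) Ω[Γ(X, U)⁄k])
    (hb : ∀ i, b i = KaehlerDifferential.D k Γ(X, U) (f i)) (g : Γ(X, U)) :
    ∃ c : Module.Basis ι Γ(X, X.basicOpen g) Ω[Γ(X, X.basicOpen g)⁄k],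
      ∀ i, c i = KaehlerDifferential.D k _ (X.presheaf.map (homOfLE (X.basicOpen_le g)).op (f i)) :=
  have := hU.isLocalization_basicOpen g
  have := isScalarTower_basicOpen k g
  have : Algebra.FormallyEtale Γ(X, U) Γ(X, X.basicOpen g) :=
    .of_isLocalization (Submonoid.powers g)
  exists_basis_kaehlerDifferential_of_formallyEtale b hb

theorem principalPartsRes_monomial {ι κ : Type*} [Finite ι] (n : ℕ) {U W : X.Opens} (i : W ⟶ U)
    (f : ι → Γ(X, U)) (e : κ → Γ(M, U)) (j : exponents ι n × κ) :
    principalPartsRes k M n i (ModulePrincipalParts.monomial k f n e j) =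
      ModulePrincipalParts.monomial k (fun a ↦ X.presheaf.map i.op (f a)) n
        (fun l ↦ M.presheaf.map i.op (e l)) j := by
  refine (principalPartsRes_tmul k M n i _ _).trans ?_
  rw [PrincipalParts.map_monomial]
  rfl

theorem exists_isFrame_principalParts [CharZero k]
    [LocallyOfFiniteType (X ↘ Spec (CommRingCat.of k))] (hM : M.IsLocallyFreeOfFiniteRank) {x : X}
    (hx : IsRegularLocalRing (X.presheaf.stalk x)) (n : ℕ) :
    ∃ U : X.Opens, x ∈ U ∧ ∃ (J : Type u) (_ : Finite J) (σ : J → Γ(principalParts k M n, U)),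
      IsFrame σ := by
  obtain ⟨N, hxN, κ, hκ, e, he⟩ := exists_isFrame_of_isLocallyFreeOfFiniteRank hM x
  obtain ⟨U, hUN, hxU, hU, d, f, b, hb⟩ := exists_basis_kaehlerDifferential_sections k hx hxN
  let β := ModulePrincipalParts.monomial k f n fun l ↦ M.presheaf.map (homOfLE hUN).op (e l)
  refine ⟨U, hxU, exponents (Fin d) n × κ, inferInstance,
    fun j ↦ principalPartsSection k M n U (β j),
    isFrame_principalPartsSection fun W hW y hy ↦ ?_⟩
  obtain ⟨g, hgW, hyg⟩ := hU.exists_basicOpen_le ⟨y, hy⟩ (hW hy)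
  obtain ⟨c, hc⟩ := exists_basis_kaehlerDifferential_basicOpen hU b hb g
  have : IsAddTorsionFree Γ(X, X.basicOpen g) := .of_isTorsionFree k _
  refine ⟨_, hgW, X.basicOpen_le g, ModulePrincipalParts.monomialBasis _ c hc n
    (he.basis ((X.basicOpen_le g).trans hUN)), hyg, fun j ↦ ?_⟩
  rw [ModulePrincipalParts.monomialBasis_apply, principalPartsRes_monomial]
  congr 1
  funext l
  rw [he.basis_apply, Modules.map_map, homOfLE_comp]

end PrincipalPartsOfRegular

section MatrixRightInverse

theorem exists_mul_eq_one_of_linearIndependent_row {K m n : Type*} [Field K] [Finite m]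
    [DecidableEq m] [Fintype n] {A : Matrix m n K} (hA : LinearIndependent K A.row) :
    ∃ B : Matrix n m K, A * B = 1 := by
  have := Fintype.ofFinite m
  have hrange : A.mulVecLin.range = ⊤ := Submodule.eq_top_of_finrank_eq <| by
    rw [Module.finrank_fintype_fun_eq_card]
    exact hA.rank_matrix
  exact Matrix.mulVec_surjective_iff_exists_right_inverse.1 (LinearMap.range_eq_top.1 hrange)

open AlgebraicGeometry.Scheme

variable {X : Scheme.{u}} {x : X} {U : X.Opens}

theorem evaluation_map {W : X.Opens} (h : W ≤ U) (hx : x ∈ W) (r : Γ(X, U)) :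
    X.evaluation W x hx (X.presheaf.map (homOfLE h).op r) = X.evaluation U x (h hx) r :=
  congrArg (X.residue x) (X.presheaf.germ_res_apply _ _ _ _)

theorem exists_evaluation_eq {J : Type*} [Finite J] (c : J → X.residueField x) (hx : x ∈ U) :
    ∃ (W : X.Opens) (_ : W ≤ U) (hW : x ∈ W) (t : J → Γ(X, W)),
      ∀ j, X.evaluation W x hW (t j) = c j := by
  choose s hs using fun j ↦ X.residue_surjective x (c j)
  choose W _ hxW t ht using fun j ↦ X.presheaf.exists_le_germ_eq (s j) hx
  let W' : X.Opens := U ⊓ ⟨⋂ j, W j, isOpen_iInter_of_finite fun j ↦ (W j).isOpen⟩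
  have hW' (j : J) : W' ≤ W j := inf_le_right.trans (Set.iInter_subset (fun j ↦ (W j : Set X)) j)
  have hxW' : x ∈ W' := ⟨hx, Set.mem_iInter.2 hxW⟩
  refine ⟨W', inf_le_left, hxW', fun j ↦ X.presheaf.map (homOfLE (hW' j)).op (t j), fun j ↦ ?_⟩
  rw [evaluation_map, ← hs, ← ht]
  rfl

variable {ι : Type*} [DecidableEq ι]

theorem exists_mul_eq_one_of_map_evaluation_eq_one [Fintype ι] (hx : x ∈ U) {D : Matrix ι ι Γ(X, U)}
    (hD : D.map (X.evaluation U x hx) = 1) :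
    ∃ (W : X.Opens) (h : W ≤ U) (B : Matrix ι ι Γ(X, W)),
      x ∈ W ∧ D.map (X.presheaf.map (homOfLE h).op) * B = 1 := by
  have hdet : X.evaluation U x hx D.det = 1 := by
    rw [← Matrix.det_one (n := ι), ← hD]
    exact (X.evaluation U x hx).hom.map_det D
  let ρ := (X.presheaf.map (homOfLE (X.basicOpen_le D.det)).op).hom
  have hunit : IsUnit (D.map ρ).det := by
    refine (congrArg IsUnit (ρ.map_det D)).mp ?_
    exact RingedSpace.isUnit_res_basicOpen X.toRingedSpace D.det
  refine ⟨X.basicOpen D.det, X.basicOpen_le _, (D.map ρ)⁻¹, ?_, Matrix.mul_nonsing_inv _ hunit⟩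
  rw [← X.evaluation_ne_zero_iff_mem_basicOpen x hx, hdet]
  exact one_ne_zero

theorem exists_mul_eq_one_of_linearIndependent_evaluation [Finite ι] {J : Type*} [Fintype J]
    (hx : x ∈ U) {A : Matrix ι J Γ(X, U)}
    (hA : LinearIndependent (X.residueField x) (A.map (X.evaluation U x hx)).row) :
    ∃ (W : X.Opens) (h : W ≤ U) (C : Matrix J ι Γ(X, W)),
      x ∈ W ∧ A.map (X.presheaf.map (homOfLE h).op) * C = 1 := by
  have := Fintype.ofFinite ι
  obtain ⟨B, hB⟩ := exists_mul_eq_one_of_linearIndependent_row hA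
  obtain ⟨W, hW, hxW, t, ht⟩ := exists_evaluation_eq (fun p : J × ι ↦ B p.1 p.2) hx
  let C : Matrix J ι Γ(X, W) := .of fun j i ↦ t (j, i)
  let A' : Matrix ι J Γ(X, W) := A.map (X.presheaf.map (homOfLE hW).op)
  have hA' : A'.map (X.evaluation W x hxW) = A.map (X.evaluation U x hx) :=
    Matrix.ext fun i j ↦ evaluation_map hW hxW (A i j)
  have hC : C.map (X.evaluation W x hxW) = B := Matrix.ext fun j i ↦ ht (j, i)
  have hAC : (A' * C).map (X.evaluation W x hxW) = 1 := by
    rw [← hB, ← hA', ← hC]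
    exact Matrix.map_mul (f := (X.evaluation W x hxW).hom)
  obtain ⟨Z, hZ, D, hxZ, hD⟩ := exists_mul_eq_one_of_map_evaluation_eq_one hxW hAC
  refine ⟨Z, hZ.trans hW, C.map (X.presheaf.map (homOfLE hZ).op) * D, hxZ, ?_⟩
  have hmap : A.map (X.presheaf.map (homOfLE (hZ.trans hW)).op) =
      A'.map (X.presheaf.map (homOfLE hZ).op) :=
    Matrix.ext fun i j ↦ (Modules.ring_map_map (homOfLE hW) (homOfLE hZ) (A i j)).symm
  rw [← hD, hmap, ← Matrix.mul_assoc]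
  congr 1
  exact (Matrix.map_mul (f := (X.presheaf.map (homOfLE hZ).op).hom)).symm

end MatrixRightInverse

section Truncation

variable {k R M : Type*} [CommRing k] [CommRing R] [Algebra k R] [AddCommGroup M] [Module R M]
  {m n : ℕ}

/-- The projection from the principal parts of order `n` to those of order `m ≤ n`, linear over
the right structure maps. -/
noncomputable def PrincipalParts.truncate (h : m ≤ n) :
    PrincipalParts k R n →ₐ[R] PrincipalParts k R m where
  __ := Ideal.Quotient.factor (Ideal.pow_le_pow_right (Nat.succ_le_succ h))
  commutes' _ := rfl

theorem PrincipalParts.truncate_left (h : m ≤ n) (r : R) :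
    truncate h (left k R n r) = left k R m r := rfl

theorem PrincipalParts.truncate_map {S : Type*} [CommRing S] [Algebra k S] (h : m ≤ n)
    (φ : R →ₐ[k] S) (p : PrincipalParts k R n) :
    truncate h (map n φ p) = map m φ (truncate h p) := by
  obtain ⟨p, rfl⟩ := mk_surjective n p
  rfl

/-- The projection from the principal parts of order `n` of a module to those of order `m ≤ n`. -/
noncomputable def ModulePrincipalParts.truncate (h : m ≤ n) :
    ModulePrincipalParts k R n M →+ ModulePrincipalParts k R m M :=
  ((PrincipalParts.truncate (k := k) (R := R) h).toLinearMap.rTensor M).toAddMonoidHom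

theorem ModulePrincipalParts.truncate_tmul (h : m ≤ n) (p : PrincipalParts k R n) (x : M) :
    truncate h (tmul n p x) = tmul m (PrincipalParts.truncate h p) x := rfl

theorem ModulePrincipalParts.truncate_smul (h : m ≤ n) (r : R)
    (x : ModulePrincipalParts k R n M) : truncate h (r • x) = r • truncate h x := by
  induction x using induction_on with
  | zero => simp only [smul_zero, map_zero]
  | tmul p x =>
    simp only [smul_def, smul_tmul, truncate_tmul, map_mul, PrincipalParts.truncate_left]
  | add x y hx hy => simp only [smul_add, map_add, hx, hy]

theorem ModulePrincipalParts.truncate_d (h : m ≤ n) (x : M) :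
    truncate h (d k R n M x) = d k R m M x := by
  rw [d_apply, truncate_tmul, map_one, d_apply]

open AlgebraicGeometry.Scheme

variable {k : Type u} [Field k] {X : Scheme.{u}} [X.Over (Spec (CommRingCat.of k))]
  {M : X.Modules}

theorem truncate_principalPartsRes (h : m ≤ n) {U W : X.Opens} (i : W ⟶ U)
    (p : ModulePrincipalParts k Γ(X, U) n Γ(M, U)) :
    ModulePrincipalParts.truncate h (principalPartsRes k M n i p) =
      principalPartsRes k M m i (ModulePrincipalParts.truncate h p) := by
  induction p using ModulePrincipalParts.induction_on with
  | zero => simp only [map_zero]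
  | tmul p s =>
    simp only [principalPartsRes_tmul, ModulePrincipalParts.truncate_tmul,
      PrincipalParts.truncate_map]
  | add p q hp hq => simp only [map_add, hp, hq]

variable (k M) in
/-- The projection from the presheaf of principal parts of order `n` to that of order `m ≤ n`. -/
noncomputable def principalPartsAbTruncate (h : m ≤ n) :
    principalPartsAb k M n ⟶ principalPartsAb k M m where
  app U := AddCommGrpCat.ofHom
    (ModulePrincipalParts.truncate (k := k) (R := Γ(X, U.unop)) (M := Γ(M, U.unop)) h)
  naturality _ _ i := by
    ext p
    exact truncate_principalPartsRes h i.unop p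

variable (k M) in
/-- The projection from the sheaf of principal parts of order `n` to that of order `m ≤ n`. -/
noncomputable def principalPartsTruncate (h : m ≤ n) :
    principalParts k M n ⟶ principalParts k M m :=
  (PresheafOfModules.sheafification (𝟙 X.ringCatSheaf.obj)).map <|
    PresheafOfModules.homMk (M₁ := principalPartsPresheaf k M n)
      (M₂ := principalPartsPresheaf k M m) (principalPartsAbTruncate k M h) fun U r p ↦
        ModulePrincipalParts.truncate_smul (R := Γ(X, U.unop)) (M := Γ(M, U.unop)) h r p

theorem principalPartsTruncate_app_dSections (h : m ≤ n) {U : X.Opens} (s : Γ(M, U)) :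
    (principalPartsTruncate k M h).app U (dSections k M n U s) = dSections k M m U s := by
  have hnat := NatTrans.congr_app
    (toSheafify_naturality (Opens.grothendieckTopology X) (principalPartsAbTruncate k M h)) (op U)
  refine congr($hnat (ModulePrincipalParts.d k Γ(X, U) n Γ(M, U) s)).symm.trans ?_
  exact congrArg ((toPrincipalParts k M m).app (op U)) (ModulePrincipalParts.truncate_d h s)

end Truncation

section Fibre

open AlgebraicGeometry.Scheme

variable {X : Scheme.{u}} {F : X.Modules} {x : X} {U : X.Opens}

/-- The value of a section at a point, in the fibre. -/
noncomputable def fibreValue (F : X.Modules) (hx : x ∈ U) : Γ(F, U) →+ F.fibre x where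
  toFun s := (1 : X.residueField x) ⊗ₜ[X.presheaf.stalk x] F.germ U x hx s
  map_zero' := by
    rw [map_zero]
    exact TensorProduct.tmul_zero _ _
  map_add' s t := by
    rw [map_add]
    exact TensorProduct.tmul_add _ _ _

theorem fibreValue_smul (hx : x ∈ U) (r : Γ(X, U)) (s : Γ(F, U)) :
    fibreValue F hx (r • s) = X.evaluation U x hx r • fibreValue F hx s := by
  have hsmul : fibreValue F hx (r • s) =
      (X.presheaf.germ U x hx r • (1 : X.residueField x)) ⊗ₜ[X.presheaf.stalk x]
        F.germ U x hx s := by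
    rw [TensorProduct.smul_tmul, ← F.germ_smul]
    rfl
  rw [hsmul, Algebra.smul_def]
  exact (TensorProduct.smul_tmul' (X.evaluation U x hx r) (1 : X.residueField x) _).symm

theorem fibreValue_map (hx : x ∈ U) {W : X.Opens} (i : U ⟶ W) (s : Γ(F, W)) :
    fibreValue F hx (F.presheaf.map i.op s) = fibreValue F (i.le hx) s :=
  congrArg ((1 : X.residueField x) ⊗ₜ[X.presheaf.stalk x] ·)
    (TopCat.Presheaf.germ_res_apply F.presheaf i x hx s)

theorem linearIndependent_evaluation_of_linearIndependent_fibreValue {ι J : Type*} [Fintype J]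
    (hx : x ∈ U) {s : ι → Γ(F, U)} (hs : LinearIndependent (X.residueField x) (fibreValue F hx ∘ s))
    {A : Matrix ι J Γ(X, U)} {σ : J → Γ(F, U)} (hA : ∀ i, s i = ∑ j, A i j • σ j) :
    LinearIndependent (X.residueField x) (A.map (X.evaluation U x hx)).row := by
  refine LinearIndependent.of_comp
    (Fintype.linearCombination (X.residueField x) (fibreValue F hx ∘ σ)) ?_
  convert hs using 1
  funext i
  simp only [Function.comp_apply, hA, map_sum, fibreValue_smul, Fintype.linearCombination_apply]
  rfl

variable {k : Type u} [Field k] [X.Over (Spec (CommRingCat.of k))] {M : X.Modules}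
  {V : Submodule k Γ(M, ⊤)} {n : ℕ}

theorem exists_injective_taylorFibre (h : injOrderAt V x ≤ n) :
    ∃ m ≤ n, Function.Injective (taylorFibre V m x) := by
  by_contra! H
  have hle : ((n + 1 : ℕ) : ℕ∞) ≤ injOrderAt V x := le_iInf₂ fun m hm ↦
    Nat.cast_le.2 (Nat.succ_le_of_lt (lt_of_not_ge fun hmn ↦ H m hmn hm))
  exact absurd (Nat.cast_le.1 (hle.trans h)) n.lt_irrefl

theorem taylorFibre_one_tmul (hx : x ∈ U) (v : V) :
    taylorFibre V n x (1 ⊗ₜ v) = fibreValue _ hx (dSections k M n U (resTop V U v)) := by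
  have hres : dSections k M n U (resTop V U v) =
      (principalParts k M n).presheaf.map (homOfLE le_top).op (dSections k M n ⊤ v.1) :=
    (map_dSections k M n (homOfLE le_top) v.1).symm
  rw [hres, fibreValue_map, taylorFibre, LinearMap.liftBaseChange_tmul, one_smul]
  rfl

theorem linearIndependent_fibreValue_dSections {ι : Type*} (b : Module.Basis ι k V) (hx : x ∈ U)
    (hinj : Function.Injective (taylorFibre V n x)) :
    LinearIndependent (X.residueField x)
      (fibreValue _ hx ∘ fun i ↦ dSections k M n U (resTop V U (b i))) := by
  have hcomp : (fibreValue _ hx ∘ fun i ↦ dSections k M n U (resTop V U (b i))) =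
      taylorFibre V n x ∘ b.baseChange (X.residueField x) := by
    funext i
    simp only [Function.comp_apply, Module.Basis.baseChange_apply, taylorFibre_one_tmul hx]
  rw [hcomp]
  exact (b.baseChange (X.residueField x)).linearIndependent.map' _ (LinearMap.ker_eq_bot.2 hinj)

theorem linearIndependent_evaluation_of_injOrderAt_le {ι J : Type*} [Fintype J]
    (b : Module.Basis ι k V) (hx : x ∈ U) (hn : injOrderAt V x ≤ n) {A : Matrix ι J Γ(X, U)}
    {σ : J → Γ(principalParts k M n, U)}
    (hA : ∀ i, dSections k M n U (resTop V U (b i)) = ∑ j, A i j • σ j) :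
    LinearIndependent (X.residueField x) (A.map (X.evaluation U x hx)).row := by
  obtain ⟨m, hmn, hinj⟩ := exists_injective_taylorFibre hn
  refine linearIndependent_evaluation_of_linearIndependent_fibreValue hx
    (linearIndependent_fibreValue_dSections b hx hinj)
    (σ := fun j ↦ (principalPartsTruncate k M hmn).app U (σ j)) fun i ↦ ?_
  rw [← principalPartsTruncate_app_dSections hmn, hA, map_sum]
  exact Finset.sum_congr rfl fun j _ ↦ (principalPartsTruncate k M hmn).app_smul _ _

end Fibre

section LocalSplitting

open AlgebraicGeometry.Scheme

variable {X : Scheme.{u}} {F G : X.Modules}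

namespace IsFrame

variable {g : F ⟶ G} {U : X.Opens} {J : Type*} {τ : J → Γ(G, U)} {s : J → Γ(F, U)}

theorem app_lift_app (hτ : IsFrame τ) (hs : ∀ j, g.app U (s j) = τ j) {W : X.Opens} (h : W ≤ U)
    (t : Γ(G, W)) : g.app W ((hτ.lift s).app W h t) = t := by
  induction (hτ.basis h).mem_span t using Submodule.span_induction with
  | mem t ht =>
    obtain ⟨j, rfl⟩ := ht
    rw [basis_apply, (hτ.lift s).map_res le_rfl (homOfLE h), lift_apply, ← presheaf_map_app, hs]
  | zero => simp only [map_zero]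
  | add t t' _ _ ht ht' => simp only [map_add, ht, ht']
  | smul r t _ ht => simp only [Modules.LocalHom.map_smul, Modules.Hom.app_smul, ht]

end IsFrame

/-- A local homomorphism over `U` as a morphism of the restrictions to the open subscheme `U`. -/
noncomputable def restrictHom {U : X.Opens} (P : Modules.LocalHom F G U) :
    F.restrict U.ι ⟶ G.restrict U.ι :=
  ⟨PresheafOfModules.homMk
    { app := fun W ↦ AddCommGrpCat.ofHom (P.app (U.ι ''ᵁ W.unop) (U.ι_image_le _))
      naturality := fun W _ i ↦ by
        ext s
        exact P.map_res (U.ι_image_le W.unop) (U.ι.opensFunctor.map i.unop) s }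
    fun W r s ↦ P.map_smul (U.ι_image_le W.unop) ((U.ι.appIso W.unop).inv r) s⟩

theorem mono_of_app_injective {f : F ⟶ G} (hf : ∀ U, Function.Injective (f.app U)) : Mono f where
  right_cancellation a b hab := Modules.hom_ext _ _ fun U ↦ by
    ext t
    exact hf U congr(($hab).app U t)

theorem epi_of_locally_surjective {g : F ⟶ G}
    (hg : ∀ x : X, ∃ U : X.Opens, x ∈ U ∧ ∀ W ≤ U, Function.Surjective (g.app W)) : Epi g where
  left_cancellation {T} a b hab := Modules.hom_ext _ _ fun U ↦ by
    ext t
    choose W hxW hW using hg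
    refine T.eq_of_locally_eq (fun x : U ↦ U ⊓ W x) U (fun _ ↦ inf_le_left)
      (fun x hx ↦ Opens.mem_iSup.2 ⟨⟨x, hx⟩, hx, hxW x⟩) _ _ fun x ↦ ?_
    obtain ⟨s, hs⟩ := hW x (U ⊓ W x) inf_le_right (G.presheaf.map (homOfLE inf_le_left).op t)
    rw [presheaf_map_app, presheaf_map_app, ← hs]
    exact congr(($hab).app (U ⊓ W x) s)

section ShortComplex

variable {S : ShortComplex X.Modules} (hf : ∀ U, Function.Injective (S.f.app U))
  (hfg : ∀ U, Function.Exact (S.f.app U) (S.g.app U))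

include hf hfg

theorem exists_comp_f_eq {T : X.Modules} (a : T ⟶ S.X₂) (ha : a ≫ S.g = 0) :
    ∃ l : T ⟶ S.X₁, l ≫ S.f = a := by
  choose l hl using fun (U : X.Opens) (t : Γ(T, U)) ↦
    (hfg U (a.app U t)).1 congr(($ha).app U t)
  refine ⟨⟨PresheafOfModules.homMk
    { app := fun U ↦ AddCommGrpCat.ofHom (AddMonoidHom.mk' (l U.unop) fun t t' ↦ hf U.unop ?_)
      naturality := fun U W i ↦ ?_ } fun U r t ↦ hf U.unop ?_⟩, ?_⟩
  · refine (hl U.unop _).trans ((map_add (a.app U.unop).hom t t').trans ?_)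
    refine (congrArg₂ (· + ·) (hl U.unop t) (hl U.unop t')).symm.trans ?_
    exact (map_add (S.f.app U.unop).hom _ _).symm
  · ext t
    refine hf W.unop ?_
    refine (hl W.unop _).trans ?_
    exact (presheaf_map_app a i.unop t).symm.trans
      ((congrArg _ (hl U.unop t).symm).trans (presheaf_map_app S.f i.unop _))
  · exact (hl U.unop _).trans ((a.app_smul _ _).trans
      ((congrArg _ (hl U.unop t).symm).trans (S.f.app_smul _ _).symm))
  · exact Modules.hom_ext _ _ fun U ↦ by
      ext t
      exact hl U t

theorem exact_of_app_exact : S.Exact :=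
  have := mono_of_app_injective hf
  S.exact_of_f_is_kernel <| Limits.KernelFork.IsLimit.ofι' S.f S.zero fun a ha ↦
    ⟨_, (exists_comp_f_eq hf hfg a ha).choose_spec⟩

variable (hg : ∀ x : X, ∃ U : X.Opens, x ∈ U ∧ ∃ (J : Type u) (τ : J → Γ(S.X₃, U)),
  IsFrame τ ∧ ∀ j, ∃ s, S.g.app U s = τ j)

include hg

theorem shortExact_of_isFrame : S.ShortExact where
  exact := exact_of_app_exact hf hfg
  mono_f := mono_of_app_injective hf
  epi_g := epi_of_locally_surjective fun x ↦ by
    obtain ⟨U, hxU, J, τ, hτ, hs⟩ := hg x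
    choose s hs using hs
    exact ⟨U, hxU, fun W hW t ↦ ⟨_, hτ.app_lift_app hs hW t⟩⟩

theorem isLocallySplit_of_isFrame : Modules.IsLocallySplit S := fun x ↦ by
  obtain ⟨U, hxU, J, τ, hτ, hs⟩ := hg x
  choose s hs using hs
  have hf' (W : U.toScheme.Opens) :
      Function.Injective ((S.map (Modules.restrictFunctor U.ι)).f.app W) := hf (U.ι ''ᵁ W)
  refine ⟨U, hxU, ⟨.ofExactOfSection _ (exact_of_app_exact hf' fun W ↦ hfg (U.ι ''ᵁ W))
    (restrictHom (hτ.lift s)) (Modules.hom_ext _ _ fun W ↦ ?_) (mono_of_app_injective hf')⟩⟩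
  ext t
  exact hτ.app_lift_app hs (U.ι_image_le W) t

end ShortComplex

end LocalSplitting

section Evaluation

open AlgebraicGeometry.Scheme

variable {k : Type u} [Field k] {X : Scheme.{u}} [X.Over (Spec (CommRingCat.of k))]
  {M : X.Modules} {V : Submodule k Γ(M, ⊤)} {n : ℕ} {ι : Type*} (b : Module.Basis ι k V)
  {U : X.Opens}

theorem dSections_resTop_eq_sum_map {J : Type*} [Fintype J] {A : Matrix ι J Γ(X, U)}
    {σ : J → Γ(principalParts k M n, U)}
    (hA : ∀ i, dSections k M n U (resTop V U (b i)) = ∑ j, A i j • σ j) {W : X.Opens} (h : W ≤ U)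
    (i : ι) :
    dSections k M n W (resTop V W (b i)) = ∑ j, A.map (X.presheaf.map (homOfLE h).op) i j •
      (principalParts k M n).presheaf.map (homOfLE h).op (σ j) := by
  rw [← map_resTop V (homOfLE h), ← map_dSections, hA, map_sum]
  exact Finset.sum_congr rfl fun j _ ↦ (principalParts k M n).map_smul (homOfLE h) (A i j) (σ j)

theorem injective_annι_app : Function.Injective ((annι V n).app U) := Subtype.val_injective

variable [FiniteDimensional k V]

theorem exact_annι_app_evalMap_app :
    Function.Exact ((annι V n).app U) ((evalMap V n).app U) := by
  refine fun P ↦ ⟨fun hP ↦ ⟨⟨P, fun v ↦ ?_⟩, rfl⟩, ?_⟩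
  · have h : evalSections V n U P = 0 := hP
    refine (toHom_evalSections V n P v).symm.trans ?_
    rw [h, map_zero, LinearMap.zero_apply]
  · rintro ⟨P, rfl⟩
    exact congr(($((evalSequence V n).zero)).app U P)

/-- The coordinates of a section of `V^* ⊗[k] M` with respect to a basis of `V`. -/
noncomputable def dualTensorEquiv (U : X.Opens) :
    Γ(dualTensor V, U) ≃ₗ[Γ(X, U)] (ι → Γ(M, U)) where
  toFun t i := DualTensor.toHom V U t (b i)
  map_add' t t' := funext fun i ↦ congr($(map_add (DualTensor.toHom V U) t t') (b i))
  map_smul' r t := funext fun i ↦ DualTensor.toHom_smul V r t (b i)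
  invFun c := (DualTensor.equivHom V U).symm (b.constr k c)
  left_inv t := DualTensor.ext V fun v ↦ by
    rw [DualTensor.toHom_equivHom_symm]
    exact LinearMap.congr_fun (b.constr_self k (DualTensor.toHom V U t)) v
  right_inv c := funext fun i ↦
    (congr($(DualTensor.toHom_equivHom_symm V (b.constr k c)) (b i))).trans (b.constr_basis k c i)

theorem dualTensorEquiv_tmul_coord [DecidableEq ι] (i : ι) (m : Γ(M, U)) :
    dualTensorEquiv b U (DualTensor.tmul V (b.coord i) m) = Pi.single i m := by
  funext l
  refine (DualTensor.toHom_tmul V _ _ _).trans ?_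
  rw [b.coord_apply, b.repr_self, Finsupp.single_apply, Pi.single_apply, ite_smul, one_smul,
    zero_smul]

theorem isFrame_tmul_coord [Finite ι] {κ : Type*} {e : κ → Γ(M, U)} (he : IsFrame e) :
    IsFrame (F := dualTensor V) (U := U)
      fun p : (_ : ι) × κ ↦ DualTensor.tmul V (b.coord p.1) (e p.2) := by
  classical
  have := Fintype.ofFinite ι
  refine isFrame_of_basis fun W h ↦
    ⟨(Pi.basis fun _ ↦ he.basis h).map (dualTensorEquiv b W).symm, fun p ↦ ?_⟩
  rw [Module.Basis.map_apply, Pi.basis_apply, LinearEquiv.symm_apply_eq, he.basis_apply]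
  exact (dualTensorEquiv_tmul_coord b _ _).symm

theorem exists_evalSections_eq_tmul_coord [DecidableEq ι] [Finite ι] {J : Type*} [Fintype J]
    {σ : J → Γ(principalParts k M n, U)} (hσ : IsFrame σ) {A : Matrix ι J Γ(X, U)}
    (hA : ∀ i, dSections k M n U (resTop V U (b i)) = ∑ j, A i j • σ j) {C : Matrix J ι Γ(X, U)}
    (hAC : A * C = 1) (i : ι) (m : Γ(M, U)) :
    ∃ P, evalSections V n U P = DualTensor.tmul V (b.coord i) m := by
  refine ⟨hσ.lift fun j ↦ C j i • m, (dualTensorEquiv b U).injective ?_⟩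
  rw [dualTensorEquiv_tmul_coord]
  funext l
  calc DualTensor.toHom V U (evalSections V n U (hσ.lift fun j ↦ C j i • m)) (b l)
      = (hσ.lift fun j ↦ C j i • m).app U le_rfl (∑ j, A l j • σ j) := by
        rw [toHom_evalSections, ← hA]
        rfl
    _ = (A * C) l i • m := by
        simp only [map_sum, Modules.LocalHom.map_smul, hσ.lift_apply, smul_smul, Matrix.mul_apply,
          Finset.sum_smul]
    _ = (Pi.single i m : ι → Γ(M, U)) l := by
        rw [hAC, Matrix.one_apply, Pi.single_apply, ite_smul, one_smul, zero_smul]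

theorem exists_isFrame_dualTensor [CharZero k] [LocallyOfFiniteType (X ↘ Spec (CommRingCat.of k))]
    (hM : M.IsLocallyFreeOfFiniteRank) {x : X} (hx : IsRegularLocalRing (X.presheaf.stalk x))
    (hn : injOrderAt V x ≤ n) :
    ∃ U : X.Opens, x ∈ U ∧ ∃ (J : Type u) (τ : J → Γ(dualTensor V, U)),
      IsFrame τ ∧ ∀ j, ∃ P, (evalMap V n).app U P = τ j := by
  obtain ⟨U₁, hxU₁, J, _, σ, hσ⟩ := exists_isFrame_principalParts (k := k) hM hx n
  obtain ⟨U₂, hxU₂, κ, _, e, he⟩ := exists_isFrame_of_isLocallyFreeOfFiniteRank hM x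
  have := Fintype.ofFinite J
  let b := Module.finBasis k V
  replace hσ := hσ.restrict (inf_le_left : U₁ ⊓ U₂ ≤ U₁)
  replace he := he.restrict (inf_le_right : U₁ ⊓ U₂ ≤ U₂)
  choose A hA using fun i ↦ hσ.exists_eq_sum_smul (dSections k M n _ (resTop V _ (b i)))
  obtain ⟨W, hW, C, hxW, hAC⟩ := exists_mul_eq_one_of_linearIndependent_evaluation _
    (linearIndependent_evaluation_of_injOrderAt_le b (And.intro hxU₁ hxU₂) hn hA)
  refine ⟨W, hxW, _, _, isFrame_tmul_coord b (he.restrict hW), fun p ↦ ?_⟩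
  exact exists_evalSections_eq_tmul_coord b (hσ.restrict hW) (dSections_resTop_eq_sum_map b hA hW)
    hAC p.1 _

end Evaluation

theorem mainTheorem3_general (k : Type u) [Field k] [CharZero k]
    (X : Scheme.{u}) [X.Over (Spec (CommRingCat.of k))]
    [LocallyOfFiniteType (X ↘ Spec (CommRingCat.of k))]
    (hreg : ∀ x : X, IsRegularLocalRing (X.presheaf.stalk x))
    (M : X.Modules) (hM : M.IsLocallyFreeOfFiniteRank)
    (V : Submodule k Γ(M, ⊤)) [FiniteDimensional k V]
    (n : ℕ) (hn : Scheme.injOrder V ≤ n) :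
    (Scheme.evalSequence V n).ShortExact ∧
      Scheme.Modules.IsLocallySplit (Scheme.evalSequence V n) := by
  have hlift (x : X) := exists_isFrame_dualTensor hM (hreg x) ((le_iSup _ x).trans hn)
  have hinj (U : X.Opens) := injective_annι_app (V := V) (n := n) (U := U)
  have hexact (U : X.Opens) := exact_annι_app_evalMap_app (V := V) (n := n) (U := U)
  exact ⟨shortExact_of_isFrame hinj hexact hlift, isLocallySplit_of_isFrame hinj hexact hlift⟩

theorem mainTheorem3 (k : Type u) [Field k] [CharZero k]
    (X : Scheme.{u}) [X.Over (Spec (CommRingCat.of k))]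
    [IrreducibleSpace X]
    [LocallyOfFiniteType (X ↘ Spec (CommRingCat.of k))]
    [QuasiCompact (X ↘ Spec (CommRingCat.of k))]
    (hreg : ∀ x : X, IsRegularLocalRing (X.presheaf.stalk x))
    (M : X.Modules) (hM : M.IsLocallyFreeOfFiniteRank)
    (V : Submodule k Γ(M, ⊤)) [FiniteDimensional k V]
    (hV : Scheme.IsSeparatedSubspace V)
    (n : ℕ) (hn : Scheme.injOrder V ≤ n) :
    (Scheme.evalSequence V n).ShortExact ∧
      Scheme.Modules.IsLocallySplit (Scheme.evalSequence V n) :=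
  mainTheorem3_general k X hreg M hM V n hn
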